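/- **Corollary 1.2.** Let $\mathsf p>12$, $\mathsf K>0$, and let $w=\{w_{ij}\}_{i,j\ge 1}$ be independent real random variables on a probability space $(\Omega_w,\mathcal F_w,\mathbb P_w)$ with $$\mathbb E_w w_{ij}=0,\qquad \mathbb E_w w_{ij}^2=1,\qquad \mathbb E_w|w_{ij}|^{\mathsf p}\le \mathsf K\qquad\text{for all } i,j\ge 1.$$ Let $\xi>0$, let $\ell\ge 0$ be an integer, and let $0<\xi_1<\dots<\xi_\ell<\xi$ and $0<\zeta_1<\dots<\zeta_\ell<1$ be fixed. For $N\ge 1$ put $M=\lfloor \xi N\rfloor$. An up-right path from $(1,1)$ to $(M,N)$ is a set of squares $\sigma=\{(i_k,j_k): k=1,\dots,M+N-1\}\subset\mathbb Z_{\ge 1}^2$ with $(i_1,j_1)=(1,1)$, $(i_{M+N-1},j_{M+N-1})=(M,N)$ and $(i_{k+1}-i_k,\,j_{k+1}-j_k)\in\{(1,0),(0,1)\}$ for all $1\le k<M+N-1$. Then for all sufficiently large $N$ there is at least one up-right path from $(1,1)$ to $(M,N)$ passing through each of the points $(\lfloor \xi_i N\rfloor,\lfloor \zeta_i N\rfloor)$,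 $i=1,\dots,\ell$; and if, for such $N$, $\sigma$ is chosen uniformly from all these paths (independently of $w$), with law $\mathbb P_\sigma$, then for $\mathbb P_w$-almost every environment $w$, $$\frac{1}{\sqrt{M+N-1}}\sum_{(i,j)\in\sigma}w_{ij}\ \xrightarrow{\ \mathscr D\ }\ \mathscr N(0,1),\qquad N\to\infty,$$ where the convergence in distribution to the standard normal law is with respect to $\mathbb P_\sigma$, with $w$ fixed. -/

import Mathlib

open MeasureTheory ProbabilityTheory Filter

namespace CornerGrowth

/-- The squares of the positive quadrant of the two-dimensional integer lattice. -/
abbrev Square : Type := ℕ+ × ℕ+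

/-- `σ` is (the set of squares of) an up-right path from `(1, 1)` to `(M, N)`: its squares can be
listed as `s 1, …, s (M + N - 1)`, starting at `(1, 1)`, ending at `(M, N)`, each step being
`(1, 0)` or `(0, 1)`. There is no such path if `M = 0` or `N = 0`. -/
def IsUpRightPath (M N : ℕ) (σ : Finset Square) : Prop :=
  ∃ s : ℕ → Square,
    s 1 = (1, 1) ∧
    (((s (M + N - 1)).1 : ℕ) = M ∧ ((s (M + N - 1)).2 : ℕ) = N) ∧
    (∀ k : ℕ, 1 ≤ k → k < M + N - 1 →
      s (k + 1) = ((s k).1 + 1, (s k).2) ∨ s (k + 1) = ((s k).1, (s k).2 + 1)) ∧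
    σ = (Finset.Icc 1 (M + N - 1)).image s

/-- The up-right paths from `(1, 1)` to `(M, N)` passing through each of the points `pts i`. -/
def pathsThrough {ι : Type*} (M N : ℕ) (pts : ι → ℕ × ℕ) : Set (Finset Square) :=
  {σ | IsUpRightPath M N σ ∧ ∀ i, ∃ a ∈ σ, ((a.1 : ℕ), (a.2 : ℕ)) = pts i}

theorem pathsThrough_finite {ι : Type*} (M N : ℕ) (pts : ι → ℕ × ℕ) :
    (pathsThrough M N pts).Finite := by
  let K : ℕ+ := ⟨M + N + 1, Nat.succ_pos _⟩
  refine Set.Finite.subset (Finset.finite_toSet (Finset.Icc (1 : Square) (K, K)).powerset) ?_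
  rintro σ ⟨⟨s, h1, -, hs, rfl⟩, -⟩
  have key : ∀ k : ℕ, 1 ≤ k → k ≤ M + N - 1 →
      ((s k).1 : ℕ) ≤ k ∧ ((s k).2 : ℕ) ≤ k := by
    intro k hk
    induction k, hk using Nat.le_induction with
    | base => intro _; simp [h1]
    | succ k hk ih =>
      intro hle
      have := ih (by omega)
      rcases hs k hk (by omega) with h | h <;> rw [h] <;>
        simp only [PNat.add_coe, PNat.one_coe] <;> omega
  simp only [Finset.coe_powerset, Set.mem_preimage, Set.mem_powerset_iff, Finset.coe_subset]
  intro a ha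
  obtain ⟨k, hk, rfl⟩ := Finset.mem_image.1 ha
  obtain ⟨hk1, hk2⟩ := Finset.mem_Icc.1 hk
  have := key k hk1 hk2
  refine Finset.mem_Icc.2 ⟨⟨one_le, one_le⟩, ?_, ?_⟩ <;>
    rw [← PNat.coe_le_coe] <;> simp only [K, PNat.mk_coe] <;> omega

/-- Every set of finite sets of squares is an event. -/
instance : MeasurableSpace (Finset Square) := ⊤

instance : DiscreteMeasurableSpace (Finset Square) := ⟨fun _ => trivial⟩

/-- The law of a path `σ` chosen uniformly from all up-right paths from `(1, 1)` to `(M, N)`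
passing through each of the points `pts i`. Where there is no such path, the value is an arbitrary
probability measure. -/
noncomputable def uniformPath {ι : Type*} (M N : ℕ) (pts : ι → ℕ × ℕ) :
    Measure (Finset Square) :=
  open Classical in
  if (pathsThrough M N pts).Nonempty then uniformOn (pathsThrough M N pts) else Measure.dirac ∅

instance {ι : Type*} (M N : ℕ) (pts : ι → ℕ × ℕ) :
    IsProbabilityMeasure (uniformPath M N pts) := by
  unfold uniformPath
  split_ifs with h
  · exact isProbabilityMeasure_uniformOn (pathsThrough_finite M N pts) h
  · infer_instance

/-- The energy of a path `σ` with respect to a fixed environment `w`. -/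
def energy (w : Square → ℝ) (σ : Finset Square) : ℝ := ∑ a ∈ σ, w a

end CornerGrowth

namespace CornerGrowth
open scoped NNReal Topology

/-! Write `n = M + N - 1` and let `Y σ` be the sum of the weights along `σ` divided by `√n`. For a
fixed path, the classical central limit theorem applies under the law of the environment, and since
all paths have `n` squares, its error in characteristic function is uniform over paths
(`norm_charFun_sum_sub_le`). Hence the averages over `σ` of the expectations of `cos (t * Y σ)` and
`sin (t * Y σ)` have the Gaussian limits. What remains is that, for almost every environment, the
average over `σ` itself is close to its expectation.

This is concentration of measure. Suppose that the weight at `a` is truncated at height `B a`.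
Changing it moves the average of an `L`-Lipschitz function of `Y σ` by at most `2 * L * B a / √n`
times the probability that `σ` visits `a`. McDiarmid's inequality then has a variance proxy of order
`1 / n` times the sum over `a` of `B a ^ 2` times the squared visiting probability
(`meanSum_concentration`).

Without the factors `B a`, that sum is the expected overlap of two independent paths, of order `√n`
(`IsPathFamily.sum_sq_card_le`). Indeed, given the prescribed points, the position of the path on an
antidiagonal is hypergeometric, with probabilities at most of order the sum of the inverse square
roots of the distances to the two neighbouring prescribed antidiagonals (`hypergeometric_le`). A
path meets each antidiagonal once, so summing these bounds along it gives `√n`.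

With `B a` the power `1/5` of the antidiagonal index, the proxy is of order `n ^ (2/5 + 1/2 - 1) = n
^ (-1/10)`, and the tails are summable in `N`. The moment hypothesis makes the expected truncation
errors summable over the whole quadrant, so their total is almost surely finite and disappears after
division by `√n` (`ae_tendsto_meanSum_sub`).

Almost sure convergence is first obtained at rational frequencies. An eventual bound on the average
of `|Y σ|` makes the averages uniformly Lipschitz in `t`, which gives all real frequencies outside a
single null set (`quenched_charFun_tendsto`). Lévy's continuity theorem concludes. -/

/-! ### McDiarmid's bounded differences inequality. -/

theorem hasSubgaussianMGF_prod_of_osc {α β : Type*} [MeasurableSpace α] [MeasurableSpace β]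
    {ν : Measure α} {μ : Measure β} [IsProbabilityMeasure ν] [IsProbabilityMeasure μ]
    {f : β × α → ℝ} (hf : Measurable f) {C : ℝ} (hC : ∀ x, |f x| ≤ C) {c V : ℝ≥0}
    (hosc : ∀ a b b', |f (b, a) - f (b', a)| ≤ c)
    (hV : HasSubgaussianMGF (fun a => (∫ b, f (b, a) ∂μ) - ∫ x, f x ∂(μ.prod ν)) V ν) :
    HasSubgaussianMGF (fun x => f x - ∫ y, f y ∂(μ.prod ν)) (c ^ 2 + V) (μ.prod ν) := by
  have hint : ∀ t : ℝ, Integrable (fun x => Real.exp (t * (f x - ∫ y, f y ∂(μ.prod ν))))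
      (μ.prod ν) := by
    intro t
    refine integrable_exp_mul_of_mem_Icc (a := -C - ∫ y, f y ∂(μ.prod ν))
      (b := C - ∫ y, f y ∂(μ.prod ν)) (by fun_prop) (ae_of_all _ fun x => ?_)
    have := abs_le.1 (hC x)
    constructor <;> linarith
  refine ⟨hint, fun t => ?_⟩
  set E := ∫ y, f y ∂(μ.prod ν) with hE
  have hfm : ∀ a, Measurable fun b => f (b, a) := fun a => by fun_prop
  have hinner : ∀ a, ∫ b, Real.exp (t * (f (b, a) - E)) ∂μ
      ≤ Real.exp ((c : ℝ) ^ 2 * t ^ 2 / 2) * Real.exp (t * ((∫ b, f (b, a) ∂μ) - E)) := by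
    intro a
    obtain ⟨b₀⟩ : Nonempty β := nonempty_of_isProbabilityMeasure μ
    -- Hoeffding's lemma on an interval of length `2 * c` around an arbitrary value. This loses a
    -- factor 4 against the sharp parameter but avoids determining the exact range.
    have h1 := hasSubgaussianMGF_of_mem_Icc (μ := μ) (X := fun b => f (b, a))
      (a := f (b₀, a) - c) (b := f (b₀, a) + c) (hfm a).aemeasurable
      (ae_of_all _ fun b => by
        have := abs_le.1 (hosc a b b₀)
        constructor <;> linarith)
    have h2 := h1.mgf_le t
    have h3 : ((‖f (b₀, a) + c - (f (b₀, a) - c)‖₊ / 2) ^ 2 : ℝ≥0) = c ^ 2 := by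
      have : f (b₀, a) + c - (f (b₀, a) - c) = ((2 * c : ℝ≥0) : ℝ) := by push_cast; ring
      rw [this, Real.nnnorm_of_nonneg (by positivity)]
      ext; push_cast; ring
    rw [h3] at h2
    have h4 : ∀ b, Real.exp (t * (f (b, a) - E))
        = Real.exp (t * (f (b, a) - ∫ b, f (b, a) ∂μ))
          * Real.exp (t * ((∫ b, f (b, a) ∂μ) - E)) := by
      intro b; rw [← Real.exp_add]; congr 1; ring
    simp_rw [h4]
    rw [integral_mul_const]
    gcongr
    simpa [mgf] using h2
  have hint' := hint t
  rw [mgf, integral_prod_symm _ hint']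
  calc ∫ a, ∫ b, Real.exp (t * (f (b, a) - E)) ∂μ ∂ν
      ≤ ∫ a, Real.exp ((c : ℝ) ^ 2 * t ^ 2 / 2) * Real.exp (t * ((∫ b, f (b, a) ∂μ) - E)) ∂ν :=
        integral_mono hint'.integral_prod_right ((hV.integrable_exp_mul t).const_mul _) hinner
    _ = Real.exp ((c : ℝ) ^ 2 * t ^ 2 / 2)
          * mgf (fun a => (∫ b, f (b, a) ∂μ) - E) ν t := by
        rw [integral_const_mul, mgf]
    _ ≤ Real.exp ((c : ℝ) ^ 2 * t ^ 2 / 2) * Real.exp (V * t ^ 2 / 2) := by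
        gcongr; exact hV.mgf_le t
    _ = Real.exp (((c ^ 2 + V : ℝ≥0) : ℝ) * t ^ 2 / 2) := by
        rw [← Real.exp_add]; congr 1; push_cast; ring

/-- **McDiarmid's inequality** for a product measure. -/
theorem hasSubgaussianMGF_pi_of_bounded_differences : ∀ {n : ℕ} (μ : Fin n → Measure ℝ)
    [∀ i, IsProbabilityMeasure (μ i)] {f : (Fin n → ℝ) → ℝ} (_ : Measurable f) {C : ℝ}
    (_ : ∀ x, |f x| ≤ C) {c : Fin n → ℝ≥0}
    (_ : ∀ x i y, |f (Function.update x i y) - f x| ≤ c i),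
    HasSubgaussianMGF (fun x => f x - ∫ y, f y ∂(Measure.pi μ)) (∑ i, c i ^ 2) (Measure.pi μ) := by
  intro n
  induction n with
  | zero =>
    intro μ _ f hf C hC c h
    have : (fun x => f x - ∫ y, f y ∂(Measure.pi μ)) = fun _ => 0 := by
      funext x
      have h1 : ∀ y, f y = f x := fun y => congrArg f (Subsingleton.elim _ _)
      simp [h1]
    rw [this]
    simp
  | succ n ih =>
    intro μ _ f hf C hC c h
    have hmp := (measurePreserving_piFinSuccAbove μ 0).symm
    set e := (MeasurableEquiv.piFinSuccAbove (fun _ : Fin (n + 1) => ℝ) 0).symm with he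
    set ν : Measure (Fin n → ℝ) := Measure.pi fun j => μ ((0 : Fin (n + 1)).succAbove j) with hν
    have heq : ∀ x : ℝ × (Fin n → ℝ), e x = Fin.cons x.1 x.2 := by
      intro x
      simp [he, MeasurableEquiv.piFinSuccAbove_symm_apply, Fin.insertNthEquiv]
    have hfe : Measurable fun x => f (e x) := hf.comp e.measurable
    have hE : ∫ y, f y ∂(Measure.pi μ) = ∫ y, f (e y) ∂((μ 0).prod ν) :=
      (hmp.integral_comp' f).symm
    have hg : Measurable fun a => ∫ b, f (e (b, a)) ∂(μ 0) := by
      have : StronglyMeasurable fun a => ∫ b, f (e (b, a)) ∂(μ 0) :=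
        StronglyMeasurable.integral_prod_left (f := fun b a => f (e (b, a)))
          hfe.stronglyMeasurable
      exact this.measurable
    have hint : ∀ a, Integrable (fun b => f (e (b, a))) (μ 0) := fun a =>
      Integrable.of_bound (C := C) (by
        have : Measurable fun b => f (e (b, a)) := hfe.comp (by fun_prop)
        exact this.aestronglyMeasurable) (ae_of_all _ fun b => hC _)
    have hintp : Integrable (fun x => f (e x)) ((μ 0).prod ν) :=
      Integrable.of_bound (C := C) hfe.aestronglyMeasurable (ae_of_all _ fun b => hC _)
    -- Integrating out coordinate 0 preserves the bounded differences in the other coordinates, so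
    -- the induction hypothesis applies to the partial mean.
    have key := ih (fun j => μ ((0 : Fin (n + 1)).succAbove j)) hg (C := C)
      (fun a => by
        have := norm_integral_le_of_norm_le_const (μ := μ 0) (f := fun b => f (e (b, a))) (C := C)
          (ae_of_all _ fun b => hC _)
        simpa using this)
      (c := fun i => c i.succ)
      (fun x i y => by
        rw [← integral_sub (hint _) (hint _)]
        have := norm_integral_le_of_norm_le_const (μ := μ 0)
          (f := fun b => f (e (b, Function.update x i y)) - f (e (b, x))) (C := c i.succ)
          (ae_of_all _ fun b => by
            rw [heq, heq]
            simp only [Fin.cons_update]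
            exact h _ _ _)
        simpa using this)
    have hstep := hasSubgaussianMGF_prod_of_osc (μ := μ 0) (ν := ν) (f := fun x => f (e x)) hfe
      (C := C) (fun x => hC _) (c := c 0) (V := ∑ i : Fin n, c i.succ ^ 2)
      (fun a b b' => by
        have := h (e (b', a)) 0 b
        rw [heq, heq] at *
        simpa [Fin.update_cons_zero] using this)
      (by
        rw [integral_prod_symm _ hintp]
        exact key)
    rw [← hE] at hstep
    rw [Fin.sum_univ_succ]
    rw [← hmp.map_eq] at hstep ⊢
    have h5 := HasSubgaussianMGF.of_map (Y := e.symm) (μ := ((μ 0).prod ν).map e)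
      (X := fun x => f (e x) - ∫ y, f y ∂((μ 0).prod ν).map e)
      (c := c 0 ^ 2 + ∑ i : Fin n, c i.succ ^ 2) e.symm.measurable.aemeasurable
      (by
        rw [Measure.map_map e.symm.measurable e.measurable]
        simpa [hmp.map_eq] using hstep)
    convert h5 using 1
    funext x
    simp

/-- **McDiarmid's inequality**: a function of finitely many independent random variables with
bounded differences is sub-Gaussian. -/
theorem hasSubgaussianMGF_of_bounded_differences {Ω ι : Type*} [MeasurableSpace Ω] {P : Measure Ω}
    [IsProbabilityMeasure P] [DecidableEq ι] {X : ι → Ω → ℝ} (hX : ∀ a, Measurable (X a))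
    (hind : iIndepFun X P) (s : Finset ι) {F : (ι → ℝ) → ℝ} (hF : Measurable F)
    (hs : ∀ x y, (∀ a ∈ s, x a = y a) → F x = F y) {C : ℝ} (hC : ∀ x, |F x| ≤ C) {c : ι → ℝ≥0}
    (h : ∀ x, ∀ a ∈ s, ∀ y, |F (Function.update x a y) - F x| ≤ c a) :
    HasSubgaussianMGF (fun ω => F (fun a => X a ω) - ∫ ω', F (fun a => X a ω') ∂P)
      (∑ a ∈ s, c a ^ 2) P := by
  classical
  let e := s.equivFin
  -- The value 0 outside `s` is immaterial, since `F` depends only on the coordinates in `s`.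
  let ext : (Fin s.card → ℝ) → ι → ℝ := fun x a => if h : a ∈ s then x (e ⟨a, h⟩) else 0
  have hext : Measurable ext := by
    refine measurable_pi_iff.2 fun a => ?_
    by_cases h : a ∈ s
    · simp only [ext, h, dite_true]; fun_prop
    · simp only [ext, h, dite_false]; fun_prop
  have hupd : ∀ x i y, ext (Function.update x i y) = Function.update (ext x) (e.symm i) y := by
    intro x i y
    funext a
    by_cases ha : a = e.symm i
    · subst ha
      simp [ext]
    · rw [Function.update_of_ne ha]
      by_cases h : a ∈ s
      · simp only [ext, h, dite_true]
        rw [Function.update_of_ne]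
        rintro rfl
        exact ha (by simp)
      · simp [ext, h]
  let Y : Fin s.card → Ω → ℝ := fun i => X (e.symm i)
  have hY : iIndepFun Y P := hind.precomp (g := fun i => ((e.symm i : s) : ι))
    (Subtype.val_injective.comp e.symm.injective)
  have hlaw := hY.map_fun_eq_pi_map fun i => (hX (e.symm i)).aemeasurable
  have hprob : ∀ i, IsProbabilityMeasure (P.map (Y i)) := fun i =>
    Measure.isProbabilityMeasure_map (hX _).aemeasurable
  have key := hasSubgaussianMGF_pi_of_bounded_differences (fun i => P.map (Y i))
    (f := fun x => F (ext x)) (hF.comp hext) (fun x => hC _) (c := fun i => c (e.symm i))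
    (fun x i y => by rw [hupd]; exact h _ _ (e.symm i).2 _)
  rw [← hlaw] at key
  have hYm : Measurable fun ω i => Y i ω := measurable_pi_iff.2 fun i => hX _
  have hval : ∀ ω, F (ext fun i => Y i ω) = F fun a => X a ω := by
    intro ω
    refine hs _ _ fun a ha => ?_
    simp [ext, ha, Y]
  have hE : ∫ y, F (ext y) ∂(P.map fun ω i => X (e.symm i) ω) = ∫ ω, F (fun a => X a ω) ∂P := by
    refine (integral_map hYm.aemeasurable (f := fun y => F (ext y))
      (hF.comp hext).aestronglyMeasurable).trans ?_
    exact integral_congr_ae (ae_of_all _ hval)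
  rw [hE] at key
  have := key.of_map hYm.aemeasurable
  have hsum : ∑ i, c (e.symm i) ^ 2 = ∑ a ∈ s, c a ^ 2 := by
    rw [← Finset.sum_coe_sort s (fun a => c a ^ 2)]
    exact Equiv.sum_comp e.symm (fun a : s => c a ^ 2)
  rw [hsum] at this
  convert this using 1
  funext ω
  simp [hval]


/-! ### Stirling bounds and local estimates for binomial and hypergeometric laws. -/

/-- The Stirling ratio is decreasing, and its value at 1 is `e / √2`. -/
theorem factorial_le_stirling {n : ℕ} (hn : n ≠ 0) :
    (n.factorial : ℝ) ≤ Real.exp 1 * √n * (n / Real.exp 1) ^ n := by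
  obtain ⟨m, rfl⟩ := Nat.exists_eq_succ_of_ne_zero hn
  have h := Stirling.stirlingSeq'_antitone (Nat.zero_le m)
  simp only [Function.comp, Nat.succ_eq_add_one, zero_add, Stirling.stirlingSeq_one] at h
  rw [Stirling.stirlingSeq, div_le_iff₀ (by positivity)] at h
  refine h.trans (le_of_eq ?_)
  rw [Real.sqrt_mul (by norm_num), Nat.succ_eq_add_one]
  field_simp

theorem stirling_le_factorial (n : ℕ) :
    2 * √n * (n / Real.exp 1) ^ n ≤ (n.factorial : ℝ) := by
  refine le_trans ?_ (Stirling.le_factorial_stirling n)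
  gcongr
  rw [Real.sqrt_mul (by positivity)]
  gcongr
  rw [Real.le_sqrt (by norm_num) (by positivity)]
  nlinarith [Real.pi_gt_three]

/-- Among the Bernoulli likelihoods of `j` successes in `j + l` trials, the one with empirical
success probability is the largest. -/
theorem bernoulli_likelihood_le {q : ℝ} (hq0 : 0 ≤ q) (hq1 : q ≤ 1) {j l : ℕ} (hj : 0 < j)
    (hl : 0 < l) :
    q ^ j * (1 - q) ^ l * ((j + l : ℕ) : ℝ) ^ (j + l) ≤ (j : ℝ) ^ j * (l : ℝ) ^ l := by
  have hj' : (0 : ℝ) < j := by exact_mod_cast hj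
  have hl' : (0 : ℝ) < l := by exact_mod_cast hl
  set n : ℝ := ((j + l : ℕ) : ℝ) with hn
  have hn' : n = j + l := by simp [hn]
  -- This is `y ≤ exp (y - 1)` at `y = x / k`. For `x = q * n` and `x = (1 - q) * n` the two
  -- exponential corrections cancel, because `n = j + l`.
  have h1 : ∀ {x : ℝ} {k : ℕ}, 0 ≤ x → 0 < k → x ^ k ≤ (k : ℝ) ^ k * Real.exp (x - k) := by
    intro x k hx hk
    have hk' : (0 : ℝ) < k := by exact_mod_cast hk
    have h2 : x / k ≤ Real.exp (x / k - 1) := by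
      have := Real.add_one_le_exp (x / k - 1); linarith
    have h3 := pow_le_pow_left₀ (by positivity) h2 k
    rw [← Real.exp_nat_mul, div_pow, div_le_iff₀ (by positivity)] at h3
    refine h3.trans (le_of_eq ?_)
    rw [mul_comm]; congr 2; field_simp
  have hn0 : 0 ≤ n := by rw [hn']; positivity
  have ha := h1 (x := q * n) (by positivity) hj
  have hb := h1 (x := (1 - q) * n) (mul_nonneg (by linarith) hn0) hl
  calc q ^ j * (1 - q) ^ l * n ^ (j + l) = (q * n) ^ j * ((1 - q) * n) ^ l := by
        rw [mul_pow, mul_pow, pow_add]; ring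
    _ ≤ ((j : ℝ) ^ j * Real.exp (q * n - j)) * ((l : ℝ) ^ l * Real.exp ((1 - q) * n - l)) :=
        mul_le_mul ha hb (pow_nonneg (mul_nonneg (by linarith) hn0) _) (by positivity)
    _ = (j : ℝ) ^ j * (l : ℝ) ^ l * Real.exp ((q * n - j) + ((1 - q) * n - l)) := by
        rw [Real.exp_add]; ring
    _ = (j : ℝ) ^ j * (l : ℝ) ^ l := by
        have : (q * n - j) + ((1 - q) * n - l) = 0 := by rw [hn']; ring
        rw [this]; simp

theorem choose_mul_factorials (j l : ℕ) :
    ((j + l).choose j : ℝ) * (j.factorial * l.factorial) = (j + l).factorial := by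
  have := Nat.add_choose_mul_factorial_mul_factorial l j
  rw [add_comm l j] at this
  rw [← this]; push_cast; ring

/-- The likelihood is replaced by its maximum over `q`, and the three factorials by their Stirling
bounds. The constant on the right is 1 because `e ≤ 2 * 2`. -/
theorem binomial_interior_le {q : ℝ} (hq0 : 0 ≤ q) (hq1 : q ≤ 1) {j l : ℕ} (hj : 0 < j)
    (hl : 0 < l) :
    ((j + l).choose j : ℝ) * q ^ j * (1 - q) ^ l * (√j * √l) ≤ √((j + l : ℕ) : ℝ) := by
  have hj' : (0 : ℝ) < j := by exact_mod_cast hj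
  have hl' : (0 : ℝ) < l := by exact_mod_cast hl
  have hc := choose_mul_factorials j l
  have h1 := stirling_le_factorial j
  have h2 := stirling_le_factorial l
  have h3 := factorial_le_stirling (n := j + l) (by omega)
  have hL := bernoulli_likelihood_le hq0 hq1 hj hl
  set n : ℝ := ((j + l : ℕ) : ℝ) with hn
  set e := Real.exp 1 with he
  have he0 : 0 < e := Real.exp_pos 1
  have he4 : e ≤ 4 := by have := Real.exp_one_lt_d9; linarith
  set c : ℝ := ((j + l).choose j : ℝ) with hcdef
  have hc0 : 0 ≤ c := by positivity
  have hq1' : 0 ≤ 1 - q := by linarith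
  have hnpos : 0 < n := by rw [hn]; exact_mod_cast (by omega)
  have h4 : c * (2 * √j * (j / e) ^ j * (2 * √l * (l / e) ^ l)) ≤ e * √n * (n / e) ^ (j + l) := by
    refine le_trans ?_ h3
    rw [← hc]
    gcongr
  have h5 : c * (√j * √l) * ((j : ℝ) ^ j * (l : ℝ) ^ l) ≤ √n * n ^ (j + l) := by
    have h6 : c * (√j * √l) * ((j : ℝ) ^ j * (l : ℝ) ^ l) * (4 / e ^ (j + l))
        ≤ e * √n * n ^ (j + l) / e ^ (j + l) := by
      refine le_trans (le_of_eq ?_) (h4.trans (le_of_eq ?_))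
      · rw [div_pow, div_pow, pow_add]; field_simp; ring
      · rw [div_pow]; field_simp
    rw [mul_div_assoc', div_le_div_iff_of_pos_right (by positivity)] at h6
    have h7 : e * √n * n ^ (j + l) ≤ 4 * (√n * n ^ (j + l)) := by
      rw [mul_assoc]; gcongr
    linarith
  have hJL : 0 < (j : ℝ) ^ j * (l : ℝ) ^ l := by positivity
  refine le_of_mul_le_mul_right ?_ (pow_pos hnpos (j + l))
  calc c * q ^ j * (1 - q) ^ l * (√j * √l) * n ^ (j + l)
      = c * (√j * √l) * (q ^ j * (1 - q) ^ l * n ^ (j + l)) := by ring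
    _ ≤ c * (√j * √l) * ((j : ℝ) ^ j * (l : ℝ) ^ l) := by gcongr
    _ ≤ _ := h5

/-- The binomial probabilities of `n` trials are at most of order `n ^ (-1/2)`. -/
theorem binomial_le {q : ℝ} (hq0 : 0 < q) (hq1 : q < 1) (j l : ℕ) :
    ((j + l).choose j : ℝ) * q ^ j * (1 - q) ^ l * (q * (1 - q))
      ≤ (√((j + l + 1 : ℕ) : ℝ))⁻¹ := by
  -- One more success and one more failure remove the boundary cases `j = 0` and `l = 0`; they cost
  -- the factor `q * (1 - q)`.
  have h := binomial_interior_le hq0.le hq1.le (Nat.succ_pos j) (Nat.succ_pos l)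
  have hc1 := choose_mul_factorials j l
  have hc2 := choose_mul_factorials (j + 1) (l + 1)
  have hq1' : 0 < 1 - q := by linarith
  set c : ℝ := ((j + l).choose j : ℝ)
  have hf : ((j + 1 + (l + 1)).factorial : ℝ)
      = ((j : ℝ) + l + 2) * (j + l + 1) * (j + l).factorial := by
    have : j + 1 + (l + 1) = j + l + 1 + 1 := by ring
    rw [this, Nat.factorial_succ, Nat.factorial_succ]; push_cast; ring
  rw [hf, Nat.factorial_succ, Nat.factorial_succ, ← hc1] at hc2
  simp only [Nat.succ_eq_add_one] at h
  set c' : ℝ := ((j + 1 + (l + 1)).choose (j + 1) : ℝ)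
  have hc' : c' * ((j + 1) * (l + 1)) = ((j : ℝ) + l + 2) * (j + l + 1) * c := by
    have hp : (0 : ℝ) < j.factorial * l.factorial := by positivity
    refine mul_right_cancel₀ hp.ne' ?_
    push_cast at hc2
    linear_combination hc2
  have hj : (0 : ℝ) ≤ j := Nat.cast_nonneg j
  have hl : (0 : ℝ) ≤ l := Nat.cast_nonneg l
  have hsj : √(((j + 1 : ℕ) : ℝ)) ^ 2 = j + 1 := by rw [Real.sq_sqrt (by positivity)]; simp
  have hsl : √(((l + 1 : ℕ) : ℝ)) ^ 2 = l + 1 := by rw [Real.sq_sqrt (by positivity)]; simp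
  set a := √(((j + 1 : ℕ) : ℝ))
  set b := √(((l + 1 : ℕ) : ℝ))
  set s := √((j + 1 + (l + 1) : ℕ) : ℝ) with hs
  have hs2 : s ^ 2 = j + l + 2 := by rw [hs, Real.sq_sqrt (by positivity)]; push_cast; ring
  set r := √((j + l + 1 : ℕ) : ℝ) with hr
  have hr2 : r ^ 2 = j + l + 1 := by rw [hr, Real.sq_sqrt (by positivity)]; push_cast; ring
  have hrpos : 0 < r := by rw [hr]; positivity
  have hspos : 0 < s := by rw [hs]; positivity
  have ha : 0 ≤ a := Real.sqrt_nonneg _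
  have hb : 0 ≤ b := Real.sqrt_nonneg _
  have hab : a * b ≤ s ^ 2 / 2 := by
    have := two_mul_le_add_sq a b
    rw [hs2]; linarith
  have hsr : s ≤ 2 * r := by
    refine le_of_sq_le_sq ?_ (by positivity)
    rw [mul_pow, hs2, hr2]; linarith
  rw [← one_div, le_div_iff₀ hrpos]
  set X := q ^ j * (1 - q) ^ l * (q * (1 - q)) with hX
  have hXpos : 0 ≤ X := by positivity
  have h' : c' * X * (a * b) ≤ s := by
    refine le_trans (le_of_eq ?_) h
    rw [hX, pow_succ, pow_succ]; ring
  have hcX : s ^ 2 * r ^ 2 * (c * X) = c' * X * (a * b) * (a * b) := by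
    rw [hs2, hr2]
    have : a * b * (a * b) = (j + 1) * (l + 1) := by rw [← hsj, ← hsl]; ring
    rw [mul_assoc (c' * X), this]
    linear_combination -X * hc'
  have h6 : s ^ 2 * r ^ 2 * (c * X) ≤ s * (s ^ 2 / 2) := by
    rw [hcX]
    exact mul_le_mul h' hab (by positivity) hspos.le
  have h7 : s ^ 2 * r * (c * X * r) ≤ s ^ 2 * r * 1 := by
    calc s ^ 2 * r * (c * X * r) = s ^ 2 * r ^ 2 * (c * X) := by ring
      _ ≤ s ^ 2 * (s / 2) := h6.trans (le_of_eq (by ring))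
      _ ≤ s ^ 2 * r * 1 := by rw [mul_one]; gcongr; linarith
  have := le_of_mul_le_mul_left h7 (by positivity)
  calc _ = c * X * r := by rw [hX]; ring
    _ ≤ 1 := this

/-- The probability of the mean under a binomial law is at least of order `n ^ (-1/2)`. -/
theorem le_binomial_mean {j l : ℕ} (hj : 0 < j) (hl : 0 < l) :
    (√((j + l : ℕ) : ℝ))⁻¹ ≤ 4 * (((j + l).choose j : ℝ) *
      ((j : ℝ) / (j + l)) ^ j * ((l : ℝ) / (j + l)) ^ l) := by
  have hj' : (0 : ℝ) < j := by exact_mod_cast hj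
  have hl' : (0 : ℝ) < l := by exact_mod_cast hl
  have hc := choose_mul_factorials j l
  have h1 := factorial_le_stirling hj.ne'
  have h2 := factorial_le_stirling hl.ne'
  have h3 := stirling_le_factorial (j + l)
  have hn' : ((j + l : ℕ) : ℝ) = j + l := by push_cast; ring
  rw [hn'] at h3 ⊢
  set n : ℝ := (j : ℝ) + l with hn
  set e := Real.exp 1 with he
  have he0 : 0 < e := Real.exp_pos 1
  have he3 : e ^ 2 ≤ 8 := by have := Real.exp_one_lt_d9; nlinarith
  set c : ℝ := ((j + l).choose j : ℝ) with hcdef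
  have hnpos : 0 < n := by positivity
  have hab : √j * √l ≤ n / 2 := by
    have ha := Real.sq_sqrt hj'.le
    have hb := Real.sq_sqrt hl'.le
    have := two_mul_le_add_sq √(j : ℝ) √l
    linarith
  have h4 : 2 * √n * (n / e) ^ (j + l) ≤ c * (e * √j * (j / e) ^ j * (e * √l * (l / e) ^ l)) := by
    refine h3.trans ?_
    rw [← hc]
    gcongr
  have h5 : 2 * √n * n ^ (j + l) ≤ c * (e ^ 2 * (√j * √l)) * ((j : ℝ) ^ j * (l : ℝ) ^ l) := by
    have := mul_le_mul_of_nonneg_right h4 (pow_nonneg he0.le (j + l))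
    refine le_trans (le_of_eq ?_) (this.trans (le_of_eq ?_))
    · rw [div_pow]; field_simp
    · rw [div_pow, div_pow, pow_add]; field_simp
  have h6 : 2 * √n * n ^ (j + l) ≤ c * (8 * (n / 2)) * ((j : ℝ) ^ j * (l : ℝ) ^ l) := by
    refine h5.trans ?_
    gcongr
  rw [div_pow, div_pow]
  have h8 : 4 * (c * ((j : ℝ) ^ j / n ^ j) * ((l : ℝ) ^ l / n ^ l))
      = 4 * c * ((j : ℝ) ^ j * (l : ℝ) ^ l) / n ^ (j + l) := by
    rw [pow_add]; field_simp
  rw [h8, le_div_iff₀ (by positivity), inv_mul_le_iff₀ (by positivity)]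
  have hss : √n * √n = n := Real.mul_self_sqrt hnpos.le
  have hsn : 0 < √n := Real.sqrt_pos.2 hnpos
  set Y := (j : ℝ) ^ j * (l : ℝ) ^ l
  have h9 : √n * (2 * n ^ (j + l)) ≤ √n * (√n * (4 * c * Y)) := by
    calc _ = 2 * √n * n ^ (j + l) := by ring
      _ ≤ _ := h6
      _ = n * (4 * c * Y) := by ring
      _ = √n * √n * (4 * c * Y) := by rw [hss]
      _ = _ := by ring
  have := le_of_mul_le_mul_left h9 hsn
  have hp : 0 ≤ n ^ (j + l) := by positivity
  linarith

/-- Local bound for the hypergeometric law: with parameters bounded away from the degenerate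
ones, its probabilities are at most of order `k ^ (-1/2) + (m - k) ^ (-1/2)`. -/
theorem hypergeometric_le {δ : ℝ} (hδ : 0 < δ) {j l j' l' : ℕ}
    (h1 : δ * ((j + j') + (l + l')) ≤ ((j + j' : ℕ) : ℝ))
    (h2 : δ * ((j + j') + (l + l')) ≤ ((l + l' : ℕ) : ℝ)) (hpos : 0 < j + j' + (l + l')) :
    (((j + l).choose j : ℝ) * (j' + l').choose j') ≤
      4 / δ ^ 4 * ((√((j + l + 1 : ℕ) : ℝ))⁻¹ + (√((j' + l' + 1 : ℕ) : ℝ))⁻¹) *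
        ((j + j') + (l + l')).choose (j + j') := by
  have hm : (0 : ℝ) < (j + j') + (l + l') := by exact_mod_cast hpos
  have hA : 0 < j + j' := by
    have : (0 : ℝ) < ((j + j' : ℕ) : ℝ) := lt_of_lt_of_le (by positivity) h1
    exact_mod_cast this
  have hB : 0 < l + l' := by
    have : (0 : ℝ) < ((l + l' : ℕ) : ℝ) := lt_of_lt_of_le (by positivity) h2
    exact_mod_cast this
  have hlow := le_binomial_mean hA hB
  push_cast at h1 h2 hlow
  set m : ℝ := ((j : ℝ) + j') + (l + l') with hmdef
  -- Whatever `q` is, the powers of `q` and `1 - q` match on both sides, so the hypergeometric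
  -- probability is a product of two binomial probabilities divided by a third. This choice of `q`
  -- makes the third one the probability of the mean.
  set q : ℝ := ((j : ℝ) + j') / m with hq
  have hq1 : 1 - q = ((l : ℝ) + l') / m := by rw [hq]; field_simp; rw [hmdef]; ring
  have hqδ : δ ≤ q := by rw [hq, le_div_iff₀ hm]; exact h1
  have hqδ' : δ ≤ 1 - q := by rw [hq1, le_div_iff₀ hm]; exact h2
  have hq0 : 0 < q := by linarith
  have hq1' : 0 < 1 - q := by linarith
  have hb1 := binomial_le hq0 (by linarith) j l
  have hb2 := binomial_le hq0 (by linarith) j' l'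
  rw [← hq1] at hlow
  set c1 : ℝ := ((j + l).choose j : ℝ)
  set c2 : ℝ := ((j' + l').choose j' : ℝ)
  set c3 : ℝ := (((j + j') + (l + l')).choose (j + j') : ℝ)
  set a := √((j + l + 1 : ℕ) : ℝ) with ha
  set b := √((j' + l' + 1 : ℕ) : ℝ) with hb
  have ha0 : 0 < a := by rw [ha]; positivity
  have hb0 : 0 < b := by rw [hb]; positivity
  -- This turns the product `a⁻¹ * b⁻¹ * √m` into the sum `a⁻¹ + b⁻¹`.
  have hsm : √m ≤ a + b := by
    rw [Real.sqrt_le_left (by positivity)]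
    have : a ^ 2 = j + l + 1 := by rw [ha, Real.sq_sqrt (by positivity)]; push_cast; ring
    have : b ^ 2 = j' + l' + 1 := by rw [hb, Real.sq_sqrt (by positivity)]; push_cast; ring
    nlinarith [mul_pos ha0 hb0]
  have hsm0 : 0 < √m := Real.sqrt_pos.2 hm
  set W := q ^ (j + j') * (1 - q) ^ (l + l') with hW
  have hW0 : 0 < W := by positivity
  have hδ4 : δ ^ 4 ≤ (q * (1 - q)) ^ 2 := by
    calc δ ^ 4 = (δ * δ) ^ 2 := by ring
      _ ≤ _ := by gcongr
  have hprod : c1 * c2 * W * δ ^ 4 ≤ a⁻¹ * b⁻¹ := by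
    calc c1 * c2 * W * δ ^ 4 ≤ c1 * c2 * W * (q * (1 - q)) ^ 2 := by gcongr
      _ = (c1 * q ^ j * (1 - q) ^ l * (q * (1 - q))) *
          (c2 * q ^ j' * (1 - q) ^ l' * (q * (1 - q))) := by
        rw [hW, pow_add, pow_add]; ring
      _ ≤ _ := mul_le_mul hb1 hb2 (by positivity) (by positivity)
  have hlow' : 1 ≤ 4 * c3 * W * √m := by
    rw [inv_le_iff_one_le_mul₀ hsm0] at hlow
    refine hlow.trans (le_of_eq ?_)
    rw [hW]; ring
  have hfin : c1 * c2 * W * δ ^ 4 ≤ 4 * (a⁻¹ + b⁻¹) * c3 * W := by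
    calc c1 * c2 * W * δ ^ 4 ≤ a⁻¹ * b⁻¹ * 1 := by simpa using hprod
      _ ≤ a⁻¹ * b⁻¹ * (4 * c3 * W * (a + b)) := by
        gcongr
        refine hlow'.trans ?_
        gcongr
      _ = _ := by field_simp; ring
  have h10 : c1 * c2 * δ ^ 4 ≤ 4 * (a⁻¹ + b⁻¹) * c3 := by
    refine le_of_mul_le_mul_right ?_ hW0
    linarith
  rw [← le_div_iff₀ (by positivity)] at h10
  refine h10.trans (le_of_eq ?_)
  ring


/-! ### Up-right paths as chains in the product order, with splicing. -/

/-- The index of the antidiagonal of a square. -/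
def diag (a : Square) : ℕ := a.1 + a.2

theorem Square.le_iff {a b : Square} : a ≤ b ↔ (a.1 : ℕ) ≤ b.1 ∧ (a.2 : ℕ) ≤ b.2 := Iff.rfl

theorem Square.ext_iff {a b : Square} : a = b ↔ (a.1 : ℕ) = b.1 ∧ (a.2 : ℕ) = b.2 := by
  rw [Prod.ext_iff, PNat.coe_inj, PNat.coe_inj]

theorem diag_mono {a b : Square} (h : a ≤ b) : diag a ≤ diag b := by
  rw [Square.le_iff] at h; unfold diag; omega

/-- `diag` is strictly monotone. The uniqueness of the square of a path on an antidiagonal rests on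
this. -/
theorem Square.eq_of_le_of_diag_le {a b : Square} (h : a ≤ b) (hd : diag b ≤ diag a) : a = b := by
  rw [Square.le_iff] at h; unfold diag at hd; rw [Square.ext_iff]; omega

/-- Up-right paths from `u` to `v`, as chains of squares meeting every antidiagonal. -/
structure IsPath (u v : Square) (σ : Finset Square) : Prop where
  mem_Icc : ∀ a ∈ σ, u ≤ a ∧ a ≤ v
  chain : ∀ a ∈ σ, ∀ b ∈ σ, a ≤ b ∨ b ≤ a
  surj : ∀ d, diag u ≤ d → d ≤ diag v → ∃ a ∈ σ, diag a = d

namespace IsPath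

variable {u v x y : Square} {σ τ : Finset Square}

theorem diag_inj (h : IsPath u v σ) {a b : Square} (ha : a ∈ σ) (hb : b ∈ σ)
    (hd : diag a = diag b) : a = b := by
  rcases h.chain a ha b hb with h | h
  · exact Square.eq_of_le_of_diag_le h hd.ge
  · exact (Square.eq_of_le_of_diag_le h hd.le).symm

theorem le_of_diag_le (h : IsPath u v σ) {a b : Square} (ha : a ∈ σ) (hb : b ∈ σ)
    (hd : diag a ≤ diag b) : a ≤ b := by
  rcases h.chain a ha b hb with h | h
  · exact h
  · exact (Square.eq_of_le_of_diag_le h hd).ge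

theorem image_diag (h : IsPath u v σ) : σ.image diag = Finset.Icc (diag u) (diag v) := by
  ext d
  simp only [Finset.mem_image, Finset.mem_Icc]
  constructor
  · rintro ⟨a, ha, rfl⟩
    exact ⟨diag_mono (h.mem_Icc a ha).1, diag_mono (h.mem_Icc a ha).2⟩
  · rintro ⟨h1, h2⟩
    exact h.surj d h1 h2

theorem sum_diag (h : IsPath u v σ) (g : ℕ → ℝ) :
    ∑ a ∈ σ, g (diag a) = ∑ d ∈ Finset.Icc (diag u) (diag v), g d := by
  rw [← h.image_diag, Finset.sum_image fun a ha b hb => h.diag_inj ha hb]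

theorem card (h : IsPath u v σ) : σ.card = diag v + 1 - diag u := by
  rw [← Nat.card_Icc, ← h.image_diag,
    Finset.card_image_of_injOn fun a ha b hb => h.diag_inj ha hb]

theorem left_mem (h : IsPath u v σ) (huv : u ≤ v) : u ∈ σ := by
  obtain ⟨a, ha, hd⟩ := h.surj (diag u) le_rfl (diag_mono huv)
  rwa [Square.eq_of_le_of_diag_le (h.mem_Icc a ha).1 hd.le]

theorem right_mem (h : IsPath u v σ) (huv : u ≤ v) : v ∈ σ := by
  obtain ⟨a, ha, hd⟩ := h.surj (diag v) (diag_mono huv) le_rfl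
  rwa [← Square.eq_of_le_of_diag_le (h.mem_Icc a ha).2 hd.ge]

theorem refl (u : Square) : IsPath u u {u} where
  mem_Icc a ha := by rw [Finset.mem_singleton] at ha; simp [ha]
  chain a ha b hb := by rw [Finset.mem_singleton] at ha hb; simp [ha, hb]
  surj d h1 h2 := ⟨u, by simp, by omega⟩

theorem trans [DecidableEq Square] (h : IsPath u v σ) (h' : IsPath v x τ) (huv : u ≤ v)
    (hvx : v ≤ x) : IsPath u x (σ ∪ τ) where
  mem_Icc a ha := by
    rcases Finset.mem_union.1 ha with ha | ha
    · exact ⟨(h.mem_Icc a ha).1, (h.mem_Icc a ha).2.trans hvx⟩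
    · exact ⟨huv.trans (h'.mem_Icc a ha).1, (h'.mem_Icc a ha).2⟩
  chain a ha b hb := by
    rcases Finset.mem_union.1 ha with ha | ha <;> rcases Finset.mem_union.1 hb with hb | hb
    · exact h.chain a ha b hb
    · exact Or.inl ((h.mem_Icc a ha).2.trans (h'.mem_Icc b hb).1)
    · exact Or.inr ((h.mem_Icc b hb).2.trans (h'.mem_Icc a ha).1)
    · exact h'.chain a ha b hb
  surj d h1 h2 := by
    rcases le_total d (diag v) with hd | hd
    · obtain ⟨a, ha, hd⟩ := h.surj d h1 hd
      exact ⟨a, Finset.mem_union_left _ ha, hd⟩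
    · obtain ⟨a, ha, hd⟩ := h'.surj d hd h2
      exact ⟨a, Finset.mem_union_right _ ha, hd⟩

theorem of_covers [DecidableEq Square] (huv : u ≤ v) (hd : diag v = diag u + 1) :
    IsPath u v {u, v} where
  mem_Icc a ha := by
    rcases Finset.mem_insert.1 ha with rfl | ha
    · exact ⟨le_rfl, huv⟩
    · rw [Finset.mem_singleton] at ha; subst ha; exact ⟨huv, le_rfl⟩
  chain a ha b hb := by
    simp only [Finset.mem_insert, Finset.mem_singleton] at ha hb
    rcases ha with rfl | rfl <;> rcases hb with rfl | rfl <;> simp [huv]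
  surj d h1 h2 := by
    rcases Nat.lt_or_ge d (diag v) with h | h
    · exact ⟨u, by simp, by omega⟩
    · exact ⟨v, by simp, by omega⟩

/-- The part of a path between two of its squares is a path. -/
theorem inter_Icc [DecidableEq Square] (h : IsPath u v σ) (hx : x ∈ σ) (hy : y ∈ σ) :
    IsPath x y (σ ∩ Finset.Icc x y) where
  mem_Icc a ha := by simpa using (Finset.mem_inter.1 ha).2
  chain a ha b hb := h.chain a (Finset.mem_inter.1 ha).1 b (Finset.mem_inter.1 hb).1
  surj d h1 h2 := by
    obtain ⟨a, ha, rfl⟩ := h.surj d ((diag_mono (h.mem_Icc x hx).1).trans h1)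
      (h2.trans (diag_mono (h.mem_Icc y hy).2))
    exact ⟨a, Finset.mem_inter.2 ⟨ha, Finset.mem_Icc.2
      ⟨h.le_of_diag_le hx ha h1, h.le_of_diag_le ha hy h2⟩⟩, rfl⟩

/-- Replacing the part of a path between two of its squares. -/
theorem splice [DecidableEq Square] (h : IsPath u v σ) (hx : x ∈ σ) (hy : y ∈ σ)
    (h' : IsPath x y τ) : IsPath u v (σ \ Finset.Icc x y ∪ τ) := by
  have key : ∀ a ∈ σ \ Finset.Icc x y, ∀ b ∈ τ, a ≤ b ∨ b ≤ a := by
    intro a ha b hb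
    rw [Finset.mem_sdiff, Finset.mem_Icc] at ha
    rcases h.chain a ha.1 x hx with h1 | h1
    · exact Or.inl (h1.trans (h'.mem_Icc b hb).1)
    · rcases h.chain a ha.1 y hy with h2 | h2
      · exact absurd ⟨h1, h2⟩ ha.2
      · exact Or.inr ((h'.mem_Icc b hb).2.trans h2)
  refine ⟨fun a ha => ?_, fun a ha b hb => ?_, fun d h1 h2 => ?_⟩
  · rcases Finset.mem_union.1 ha with ha | ha
    · exact h.mem_Icc a (Finset.mem_sdiff.1 ha).1
    · exact ⟨(h.mem_Icc x hx).1.trans (h'.mem_Icc a ha).1,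
        (h'.mem_Icc a ha).2.trans (h.mem_Icc y hy).2⟩
  · rcases Finset.mem_union.1 ha with ha | ha <;> rcases Finset.mem_union.1 hb with hb | hb
    · exact h.chain a (Finset.mem_sdiff.1 ha).1 b (Finset.mem_sdiff.1 hb).1
    · exact key a ha b hb
    · exact (key b hb a ha).symm
    · exact h'.chain a ha b hb
  · by_cases hd : diag x ≤ d ∧ d ≤ diag y
    · obtain ⟨a, ha, rfl⟩ := h'.surj d hd.1 hd.2
      exact ⟨a, Finset.mem_union_right _ ha, rfl⟩
    · obtain ⟨a, ha, rfl⟩ := h.surj d h1 h2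
      refine ⟨a, Finset.mem_union_left _ (Finset.mem_sdiff.2 ⟨ha, fun hm => hd ?_⟩), rfl⟩
      rw [Finset.mem_Icc] at hm
      exact ⟨diag_mono hm.1, diag_mono hm.2⟩

end IsPath

/-- The square `u + (i, j)`. -/
def shift (u : Square) (i j : ℕ) : Square :=
  (⟨u.1 + i, by have := u.1.pos; omega⟩, ⟨u.2 + j, by have := u.2.pos; omega⟩)

@[simp] theorem shift_fst (u : Square) (i j : ℕ) : ((shift u i j).1 : ℕ) = u.1 + i := rfl

@[simp] theorem shift_snd (u : Square) (i j : ℕ) : ((shift u i j).2 : ℕ) = u.2 + j := rfl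

theorem diag_shift (u : Square) (i j : ℕ) : diag (shift u i j) = diag u + (i + j) := by
  simp only [diag, shift_fst, shift_snd]; omega

theorem le_shift (u : Square) (i j : ℕ) : u ≤ shift u i j := by
  rw [Square.le_iff]; simp

theorem exists_eq_shift {u v : Square} (h : u ≤ v) : ∃ i j, v = shift u i j := by
  rw [Square.le_iff] at h
  refine ⟨v.1 - u.1, v.2 - u.2, ?_⟩
  rw [Square.ext_iff, shift_fst, shift_snd]
  omega

/-! ### Counting paths by binomial coefficients. -/

section Count

open scoped Classical in
/-- The set of up-right paths from `u` to `v`. -/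
noncomputable def paths (u v : Square) : Finset (Finset Square) :=
  (Finset.Icc u v).powerset.filter (IsPath u v)

@[simp] theorem mem_paths {u v : Square} {σ : Finset Square} : σ ∈ paths u v ↔ IsPath u v σ := by
  simp only [paths, Finset.mem_filter, Finset.mem_powerset, and_iff_right_iff_imp]
  exact fun h a ha => Finset.mem_Icc.2 (h.mem_Icc a ha)

/-- Used for rectangles with a single row or column, where the path has no choice. -/
theorem IsPath.eq_Icc {u v : Square} {σ : Finset Square} (h : IsPath u v σ)
    (hd : ∀ a b : Square, a ∈ Finset.Icc u v → b ∈ Finset.Icc u v → diag a = diag b → a = b) :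
    σ = Finset.Icc u v := by
  ext a
  refine ⟨fun ha => Finset.mem_Icc.2 (h.mem_Icc a ha), fun ha => ?_⟩
  have ha' := Finset.mem_Icc.1 ha
  obtain ⟨b, hb, hab⟩ := h.surj (diag a) (diag_mono ha'.1) (diag_mono ha'.2)
  rwa [hd a b ha (Finset.mem_Icc.2 (h.mem_Icc b hb)) hab.symm]

theorem IsPath.exists_erase [DecidableEq Square] {u v : Square} {σ : Finset Square}
    (h : IsPath u v σ) (huv : u ≤ v) (hd : diag u < diag v) :
    ∃ w, w ≤ v ∧ diag v = diag w + 1 ∧ u ≤ w ∧ IsPath u w (σ.erase v) := by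
  obtain ⟨w, hw, hwd⟩ := h.surj (diag v - 1) (by omega) (by omega)
  have hw' := h.mem_Icc w hw
  refine ⟨w, hw'.2, by omega, hw'.1, ?_⟩
  have := h.inter_Icc (h.left_mem huv) hw
  convert this using 1
  ext a
  simp only [Finset.mem_erase, Finset.mem_inter, Finset.mem_Icc]
  constructor
  · rintro ⟨hav, ha⟩
    refine ⟨ha, (h.mem_Icc a ha).1, h.le_of_diag_le ha hw ?_⟩
    by_contra hcon
    have := diag_mono (h.mem_Icc a ha).2
    exact hav (h.diag_inj ha (h.right_mem huv) (by omega))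
  · rintro ⟨ha, -, haw⟩
    refine ⟨?_, ha⟩
    rintro rfl
    have := diag_mono haw
    omega

theorem IsPath.insert [DecidableEq Square] {u v w : Square} {σ : Finset Square}
    (h : IsPath u w σ) (huw : u ≤ w) (hwv : w ≤ v) (hd : diag v = diag w + 1) :
    IsPath u v (insert v σ) ∧ v ∉ σ := by
  refine ⟨?_, fun hv => ?_⟩
  · have := h.trans (IsPath.of_covers hwv hd) huw hwv
    convert this using 1
    ext a
    simp only [Finset.mem_insert, Finset.mem_union, Finset.mem_singleton]
    have := h.right_mem huw
    constructor
    · rintro (h | h)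
      · exact Or.inr (Or.inr h)
      · exact Or.inl h
    · rintro (h | rfl | h)
      · exact Or.inr h
      · exact Or.inr this
      · exact Or.inl h
  · have := diag_mono (h.mem_Icc v hv).2
    omega

theorem exists_isPath {u v : Square} (h : u ≤ v) : ∃ σ, IsPath u v σ := by
  classical
  obtain ⟨i, j, rfl⟩ := exists_eq_shift h
  clear h
  induction i with
  | zero =>
    induction j with
    | zero => exact ⟨{u}, IsPath.refl u⟩
    | succ j ih =>
      obtain ⟨σ, hσ⟩ := ih
      exact ⟨_, (hσ.insert (le_shift _ _ _) (by rw [Square.le_iff]; simp)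
        (by simp only [diag_shift]; omega)).1⟩
  | succ i ih =>
    obtain ⟨σ, hσ⟩ := ih
    exact ⟨_, (hσ.insert (le_shift _ _ _) (by rw [Square.le_iff]; simp)
      (by simp only [diag_shift]; omega)).1⟩

theorem exists_isPath_through [DecidableEq Square] {f : ℕ → Square} (hf : Monotone f) (n : ℕ) :
    ∃ σ, IsPath (f 0) (f n) σ ∧ ∀ i ≤ n, f i ∈ σ := by
  induction n with
  | zero => exact ⟨{f 0}, IsPath.refl _, fun i hi => by simp [Nat.le_zero.1 hi]⟩
  | succ n ih =>
    obtain ⟨σ, hσ, hi⟩ := ih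
    have h1 := hf (Nat.zero_le n)
    have h2 := hf (Nat.le_succ n)
    obtain ⟨τ, hτ⟩ := exists_isPath h2
    refine ⟨σ ∪ τ, hσ.trans hτ h1 h2, fun i hin => ?_⟩
    rcases Nat.lt_or_ge n i with h | h
    · obtain rfl : i = n + 1 := by omega
      exact Finset.mem_union_right _ (hτ.right_mem h2)
    · exact Finset.mem_union_left _ (hi i h)

theorem card_paths_eq_one {u v : Square} (h : u ≤ v)
    (hd : ∀ a b : Square, a ∈ Finset.Icc u v → b ∈ Finset.Icc u v → diag a = diag b → a = b) :
    (paths u v).card = 1 := by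
  obtain ⟨σ, hσ⟩ := exists_isPath h
  rw [Finset.card_eq_one]
  refine ⟨σ, Finset.eq_singleton_iff_unique_mem.2 ⟨mem_paths.2 hσ, fun τ hτ => ?_⟩⟩
  rw [(mem_paths.1 hτ).eq_Icc hd, hσ.eq_Icc hd]

/-- Pascal's rule: erasing the endpoint leaves a path to one of its two predecessors. The two cases
exclude each other because the predecessors lie on the same antidiagonal. -/
theorem card_paths_step (u : Square) (i j : ℕ) :
    (paths u (shift u (i + 1) (j + 1))).card =
      (paths u (shift u i (j + 1))).card + (paths u (shift u (i + 1) j)).card := by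
  classical
  set v := shift u (i + 1) (j + 1) with hv
  set w₁ := shift u i (j + 1) with hw₁
  set w₂ := shift u (i + 1) j with hw₂
  have h1 : w₁ ≤ v ∧ diag v = diag w₁ + 1 := by
    rw [hv, hw₁, Square.le_iff]; simp only [diag_shift, shift_fst, shift_snd]; omega
  have h2 : w₂ ≤ v ∧ diag v = diag w₂ + 1 := by
    rw [hv, hw₂, Square.le_iff]; simp only [diag_shift, shift_fst, shift_snd]; omega
  have hinj : ∀ w, u ≤ w → w ≤ v → diag v = diag w + 1 →
      ((paths u w).image (Insert.insert v)).card = (paths u w).card := by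
    intro w huw hwv hd
    refine Finset.card_image_of_injOn fun σ hσ τ hτ h => ?_
    have hσ' := ((mem_paths.1 hσ).insert huw hwv hd).2
    have hτ' := ((mem_paths.1 hτ).insert huw hwv hd).2
    rw [← Finset.erase_insert hσ', ← Finset.erase_insert hτ']
    exact congrArg (fun s => Finset.erase s v) h
  rw [← hinj w₁ (le_shift _ _ _) h1.1 h1.2, ← hinj w₂ (le_shift _ _ _) h2.1 h2.2,
    ← Finset.card_union_of_disjoint]
  · congr 1
    ext σ
    simp only [Finset.mem_union, Finset.mem_image, mem_paths]
    constructor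
    · intro h
      obtain ⟨w, hwv, hd, huw, hp⟩ := h.exists_erase (le_shift _ _ _)
        (by rw [hv, diag_shift]; omega)
      have hmem := h.right_mem (le_shift _ _ _)
      have hw : w = w₁ ∨ w = w₂ := by
        rw [Square.ext_iff, Square.ext_iff, hw₁, hw₂]
        rw [hv, Square.le_iff] at hwv
        rw [hv, diag_shift] at hd
        unfold diag at hd
        simp only [shift_fst, shift_snd] at hwv ⊢
        omega
      rcases hw with rfl | rfl
      · exact Or.inl ⟨_, hp, Finset.insert_erase hmem⟩
      · exact Or.inr ⟨_, hp, Finset.insert_erase hmem⟩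
    · rintro (⟨τ, hτ, rfl⟩ | ⟨τ, hτ, rfl⟩)
      · exact (hτ.insert (le_shift _ _ _) h1.1 h1.2).1
      · exact (hτ.insert (le_shift _ _ _) h2.1 h2.2).1
  · rw [Finset.disjoint_left]
    intro σ h3 h4
    obtain ⟨τ, hτ, rfl⟩ := Finset.mem_image.1 h3
    obtain ⟨τ', hτ', hh⟩ := Finset.mem_image.1 h4
    have hp := ((mem_paths.1 hτ).insert (le_shift _ _ _) h1.1 h1.2).1
    have m1 : w₁ ∈ Insert.insert v τ :=
      Finset.mem_insert_of_mem ((mem_paths.1 hτ).right_mem (le_shift _ _ _))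
    have m2 : w₂ ∈ Insert.insert v τ := by
      rw [← hh]
      exact Finset.mem_insert_of_mem ((mem_paths.1 hτ').right_mem (le_shift _ _ _))
    have := hp.diag_inj m1 m2 (by omega)
    rw [Square.ext_iff, hw₁, hw₂] at this
    simp only [shift_fst] at this
    omega

theorem card_paths (u : Square) (i j : ℕ) :
    (paths u (shift u i j)).card = (i + j).choose i := by
  induction i generalizing j with
  | zero =>
    rw [card_paths_eq_one (le_shift _ _ _)]
    · simp
    · intro a b ha hb hd
      simp only [Finset.mem_Icc, Square.le_iff, shift_fst, shift_snd] at ha hb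
      rw [Square.ext_iff]; unfold diag at hd; omega
  | succ i ih =>
    induction j with
    | zero =>
      rw [card_paths_eq_one (le_shift _ _ _)]
      · simp
      · intro a b ha hb hd
        simp only [Finset.mem_Icc, Square.le_iff, shift_fst, shift_snd] at ha hb
        rw [Square.ext_iff]; unfold diag at hd; omega
    | succ j ih' =>
      rw [card_paths_step, ih, ih']
      have h1 : i + 1 + (j + 1) = (i + (j + 1)) + 1 := by ring
      have h2 : i + 1 + j = i + (j + 1) := by ring
      rw [h1, h2, Nat.choose_succ_succ]

end Count

/-! ### Resampling a segment of a path, and the two descriptions of paths. -/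

/-- Among a splice-invariant family of paths through `u` and `v`, the proportion of paths through
`a` is at most the proportion among all the paths from `u` to `v`. -/
theorem card_through_mul_card_paths_le [DecidableEq Square] {o e u v a : Square}
    {S : Finset (Finset Square)} (hS : ∀ σ ∈ S, IsPath o e σ)
    (hu : ∀ σ ∈ S, u ∈ σ) (hv : ∀ σ ∈ S, v ∈ σ)
    (hsplice : ∀ σ ∈ S, ∀ τ, IsPath u v τ → σ \ Finset.Icc u v ∪ τ ∈ S) :
    (S.filter (a ∈ ·)).card * (paths u v).card ≤
      S.card * ((paths u a).card * (paths a v).card) := by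
  rw [← Finset.card_product, ← Finset.card_product, ← Finset.card_product]
  have hrec : ∀ σ ∈ S, a ∈ σ → ∀ τ, IsPath u v τ →
      σ = (σ \ Finset.Icc u v ∪ τ) \ Finset.Icc u v ∪
        (σ ∩ Finset.Icc u a ∪ σ ∩ Finset.Icc a v) := by
    intro σ hσ ha τ hτ
    ext b
    simp only [Finset.mem_union, Finset.mem_sdiff, Finset.mem_inter, Finset.mem_Icc]
    constructor
    · intro hb
      by_cases hm : u ≤ b ∧ b ≤ v
      · right
        rcases (hS σ hσ).chain a ha b hb with h | h
        · exact Or.inr ⟨hb, h, hm.2⟩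
        · exact Or.inl ⟨hb, hm.1, h⟩
      · exact Or.inl ⟨Or.inl ⟨hb, hm⟩, hm⟩
    · rintro (⟨h | h, hm⟩ | h | h)
      · exact h.1
      · exact absurd (hτ.mem_Icc b h) hm
      · exact h.1
      · exact h.1
  have hrec' : ∀ σ : Finset Square, ∀ τ, IsPath u v τ →
      (σ \ Finset.Icc u v ∪ τ) ∩ Finset.Icc u v = τ := by
    intro σ τ hτ
    ext b
    simp only [Finset.mem_union, Finset.mem_sdiff, Finset.mem_inter, Finset.mem_Icc]
    constructor
    · rintro ⟨h | h, hm⟩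
      · exact absurd hm h.2
      · exact h
    · exact fun h => ⟨Or.inr h, hτ.mem_Icc b h⟩
  -- The injection exchanges segments: `τ` replaces the part of `σ` between `u` and `v`, and the
  -- removed part is kept as its two halves at `a`. Gluing the halves back recovers `σ`, and cutting
  -- out the new segment recovers `τ`.
  refine Finset.card_le_card_of_injOn (fun p : Finset Square × Finset Square =>
    (p.1 \ Finset.Icc u v ∪ p.2, (p.1 ∩ Finset.Icc u a, p.1 ∩ Finset.Icc a v))) ?_ ?_
  · rintro ⟨σ, τ⟩ hp
    simp only [Finset.coe_product, Set.mem_prod, Finset.mem_coe, Finset.mem_filter,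
      mem_paths] at hp ⊢
    obtain ⟨⟨hσ, ha⟩, hτ⟩ := hp
    exact ⟨hsplice σ hσ τ hτ, (hS σ hσ).inter_Icc (hu σ hσ) ha,
      (hS σ hσ).inter_Icc ha (hv σ hσ)⟩
  · rintro ⟨σ, τ⟩ hp ⟨σ', τ'⟩ hp' heq
    simp only [Finset.coe_product, Set.mem_prod, Finset.mem_coe, Finset.mem_filter,
      mem_paths] at hp hp'
    simp only [Prod.mk.injEq] at heq
    obtain ⟨h1, h2, h3⟩ := heq
    have hτ : τ = τ' := by rw [← hrec' σ τ hp.2, h1, hrec' σ' τ' hp'.2]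
    have hσ : σ = σ' := by
      rw [hrec σ hp.1.1 hp.1.2 τ hp.2, hrec σ' hp'.1.1 hp'.1.2 τ' hp'.2, h1, h2, h3]
    rw [hσ, hτ]


/-- The `k`-th square of an enumerated path is its unique square on antidiagonal `k + 1`, since `(1,
1)` lies on antidiagonal 2. Conversely, consecutive comparable squares on consecutive antidiagonals
differ by a unit step. -/
theorem isUpRightPath_iff {e : Square} {σ : Finset Square} :
    IsUpRightPath e.1 e.2 σ ↔ IsPath (1, 1) e σ := by
  have he1 := e.1.pos
  have he2 := e.2.pos
  have h11 : ((1, 1) : Square) ≤ e := by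
    rw [Square.le_iff]; simp only [PNat.one_coe]; omega
  have hd11 : diag (1, 1) = 2 := rfl
  constructor
  · rintro ⟨s, h1, ⟨hM, hN⟩, hs, rfl⟩
    have hstep : ∀ k, 1 ≤ k → k < (e.1 : ℕ) + e.2 - 1 →
        s k ≤ s (k + 1) ∧ diag (s (k + 1)) = diag (s k) + 1 := by
      intro k hk hk'
      rcases hs k hk hk' with h | h <;> rw [h, Square.le_iff] <;> unfold diag <;>
        simp only [PNat.add_coe, PNat.one_coe] <;> omega
    have hmono : ∀ k, 1 ≤ k → ∀ k', k ≤ k' → k' ≤ (e.1 : ℕ) + e.2 - 1 →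
        s k ≤ s k' ∧ diag (s k') = diag (s k) + (k' - k) := by
      intro k hk k' hkk'
      induction k', hkk' using Nat.le_induction with
      | base => intro _; simp
      | succ k' hkk' ih =>
        intro hle
        have h3 := ih (by omega)
        have h4 := hstep k' (by omega) (by omega)
        exact ⟨h3.1.trans h4.1, by omega⟩
    have hend : s ((e.1 : ℕ) + e.2 - 1) = e := Square.ext_iff.2 ⟨hM, hN⟩
    refine ⟨fun a ha => ?_, fun a ha b hb => ?_, fun d hd1 hd2 => ?_⟩
    · obtain ⟨k, hk, rfl⟩ := Finset.mem_image.1 ha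
      rw [Finset.mem_Icc] at hk
      constructor
      · rw [← h1]; exact (hmono 1 le_rfl k hk.1 hk.2).1
      · have := (hmono k hk.1 _ hk.2 le_rfl).1
        rwa [hend] at this
    · obtain ⟨k, hk, rfl⟩ := Finset.mem_image.1 ha
      obtain ⟨k', hk', rfl⟩ := Finset.mem_image.1 hb
      rw [Finset.mem_Icc] at hk hk'
      rcases le_total k k' with h | h
      · exact Or.inl (hmono k hk.1 k' h hk'.2).1
      · exact Or.inr (hmono k' hk'.1 k h hk.2).1
    · rw [hd11] at hd1
      unfold diag at hd2
      refine ⟨s (d - 1), Finset.mem_image_of_mem _ (Finset.mem_Icc.2 (by omega)), ?_⟩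
      have := (hmono 1 le_rfl (d - 1) (by omega) (by omega)).2
      rw [h1, hd11] at this
      omega
  · intro h
    have hex : ∀ k, ∃ a, 1 ≤ k → k ≤ (e.1 : ℕ) + e.2 - 1 → a ∈ σ ∧ diag a = k + 1 := by
      intro k
      by_cases hk : 1 ≤ k ∧ k ≤ (e.1 : ℕ) + e.2 - 1
      · obtain ⟨a, ha, hd⟩ := h.surj (k + 1) (by rw [hd11]; omega) (by unfold diag; omega)
        exact ⟨a, fun _ _ => ⟨ha, hd⟩⟩
      · exact ⟨(1, 1), fun h1 h2 => absurd ⟨h1, h2⟩ hk⟩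
    choose s hs using hex
    have hend : s ((e.1 : ℕ) + e.2 - 1) = e := by
      have := hs ((e.1 : ℕ) + e.2 - 1) (by omega) le_rfl
      exact h.diag_inj this.1 (h.right_mem h11) (by rw [this.2]; unfold diag; omega)
    refine ⟨s, ?_, by rw [hend]; exact ⟨rfl, rfl⟩, fun k hk hk' => ?_, ?_⟩
    · have := hs 1 le_rfl (by omega)
      exact h.diag_inj this.1 (h.left_mem h11) (by rw [this.2, hd11])
    · have ha := hs k hk hk'.le
      have hb := hs (k + 1) (by omega) (by omega)
      have hle := h.le_of_diag_le ha.1 hb.1 (by omega)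
      rw [Square.ext_iff, Square.ext_iff]
      rw [Square.le_iff] at hle
      unfold diag at ha hb
      simp only [PNat.add_coe, PNat.one_coe]
      omega
    · ext a
      simp only [Finset.mem_image, Finset.mem_Icc]
      constructor
      · intro ha
        have h1 := diag_mono (h.mem_Icc a ha).1
        have h2 := diag_mono (h.mem_Icc a ha).2
        rw [hd11] at h1
        have h3 : diag e = e.1 + e.2 := rfl
        refine ⟨diag a - 1, by omega, ?_⟩
        have := hs (diag a - 1) (by omega) (by omega)
        exact h.diag_inj this.1 ha (by omega)
      · rintro ⟨k, hk, rfl⟩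
        exact (hs k hk.1 hk.2).1

/-! ### Visiting probabilities and the expected overlap of two paths. -/

/-- Each term is at most `2 * (√(k + 1) - √k)`, and these differences telescope. -/
theorem sum_inv_sqrt_le (n : ℕ) : ∑ k ∈ Finset.range n, (√((k + 1 : ℕ) : ℝ))⁻¹ ≤ 2 * √n := by
  induction n with
  | zero => simp
  | succ n ih =>
    rw [Finset.sum_range_succ]
    have hn : (0 : ℝ) ≤ n := Nat.cast_nonneg n
    have h1 := Real.sq_sqrt hn
    have h2 : √((n + 1 : ℕ) : ℝ) ^ 2 = n + 1 := by
      rw [Real.sq_sqrt (by positivity)]; push_cast; ring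
    set a := √(n : ℝ)
    set b := √((n + 1 : ℕ) : ℝ) with hb
    have ha0 : 0 ≤ a := Real.sqrt_nonneg _
    have hb0 : 0 < b := by rw [hb]; positivity
    have hab : a ≤ b := Real.sqrt_le_sqrt (by push_cast; linarith)
    have : b⁻¹ ≤ 2 * (b - a) := by
      rw [inv_le_iff_one_le_mul₀ hb0]
      have : (b - a) * (b + a) = 1 := by ring_nf; linarith
      nlinarith
    linarith

/-- On each side of `e` the distance to `e` is injective, so each half is bounded by the one-sided
sum. -/
theorem sum_inv_sqrt_dist_le {n e : ℕ} (he : e < n) :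
    ∑ d ∈ Finset.range n, (√((Nat.dist d e + 1 : ℕ) : ℝ))⁻¹ ≤ 4 * √n := by
  have h0 := sum_inv_sqrt_le n
  have hsub : ∀ t : Finset ℕ, (∀ d ∈ t, d < n) → (∀ d ∈ t, ∀ d' ∈ t,
      Nat.dist d e = Nat.dist d' e → d = d') →
      ∑ d ∈ t, (√((Nat.dist d e + 1 : ℕ) : ℝ))⁻¹ ≤ 2 * √n := by
    intro t ht hinj
    refine le_trans ?_ h0
    rw [← Finset.sum_image (f := fun k : ℕ => (√((k + 1 : ℕ) : ℝ))⁻¹) hinj]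
    refine Finset.sum_le_sum_of_subset_of_nonneg (fun k hk => ?_) fun _ _ _ => by positivity
    obtain ⟨d, hd, rfl⟩ := Finset.mem_image.1 hk
    have := ht d hd
    rw [Finset.mem_range]
    unfold Nat.dist
    omega
  rw [← Finset.sum_filter_add_sum_filter_not (Finset.range n) (fun d => d < e)]
  have h1 := hsub ((Finset.range n).filter (fun d => d < e))
    (fun d hd => by simp at hd; omega) (fun d hd d' hd' h => by
      simp at hd hd'; unfold Nat.dist at h; omega)
  have h2 := hsub ((Finset.range n).filter (fun d => ¬ d < e))
    (fun d hd => by simp at hd; omega) (fun d hd d' hd' h => by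
      simp at hd hd'; unfold Nat.dist at h; omega)
  linarith

/-- A chain of squares `f 0 ≤ … ≤ f n` whose consecutive increments have slopes in a compact
subset of the open quadrant, together with the family `S` of the up-right paths through it. -/
structure IsPathFamily (δ : ℝ) (n : ℕ) (f : ℕ → Square) (S : Finset (Finset Square)) : Prop where
  pos : 0 < δ
  mono : Monotone f
  mem_iff : ∀ σ, σ ∈ S ↔ IsPath (f 0) (f n) σ ∧ ∀ i ≤ n, f i ∈ σ
  diag_lt : ∀ i < n, diag (f i) < diag (f (i + 1))
  slope_fst : ∀ i < n, δ * ((diag (f (i + 1)) : ℝ) - diag (f i)) ≤ ((f (i + 1)).1 : ℝ) - (f i).1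
  slope_snd : ∀ i < n, δ * ((diag (f (i + 1)) : ℝ) - diag (f i)) ≤ ((f (i + 1)).2 : ℝ) - (f i).2

namespace IsPathFamily

variable {δ : ℝ} {n : ℕ} {f : ℕ → Square} {S : Finset (Finset Square)}

/-- An upper bound for the probability that a uniform path visits a given square of the `d`-th
antidiagonal. -/
noncomputable def hitBound (δ : ℝ) (n : ℕ) (f : ℕ → Square) (d : ℕ) : ℝ :=
  8 / δ ^ 4 * ∑ i ∈ Finset.range (n + 1), (√((Nat.dist d (diag (f i)) + 1 : ℕ) : ℝ))⁻¹

/-- A visited square lies between two consecutive points of the chain. Resampling the segment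
between them bounds its visiting probability by a hypergeometric one, and the slope conditions keep
the parameters away from degeneracy. -/
theorem card_filter_mem_le (h : IsPathFamily δ n f S) (hn : 0 < n) [DecidableEq Square]
    (a : Square) : ((S.filter (a ∈ ·)).card : ℝ) ≤ hitBound δ n f (diag a) * S.card := by
  have hδ := h.pos
  rcases (S.filter (a ∈ ·)).eq_empty_or_nonempty with hemp | ⟨σ, hσ⟩
  · rw [hemp]; unfold hitBound; simp only [Finset.card_empty, Nat.cast_zero]; positivity
  rw [Finset.mem_filter, h.mem_iff] at hσ
  obtain ⟨⟨hσ, hmem⟩, ha⟩ := hσ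
  have hex : ∃ i < n, diag (f i) ≤ diag a ∧ diag a ≤ diag (f (i + 1)) := by
    by_contra hcon
    push Not at hcon
    have : ∀ i ≤ n, diag (f i) ≤ diag a := by
      intro i
      induction i with
      | zero => exact fun _ => diag_mono (hσ.mem_Icc a ha).1
      | succ i ih => exact fun hi => (hcon i (by omega) (ih (by omega))).le
    have h1 := hcon (n - 1) (by omega) (this _ (by omega))
    rw [Nat.sub_add_cancel hn] at h1
    have := diag_mono (hσ.mem_Icc a ha).2
    omega
  obtain ⟨i, hi, hd1, hd2⟩ := hex
  have hua := hσ.le_of_diag_le (hmem i hi.le) ha hd1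
  have hav := hσ.le_of_diag_le ha (hmem (i + 1) hi) hd2
  have hcount := card_through_mul_card_paths_le (S := S) (o := f 0) (e := f n) (u := f i)
    (v := f (i + 1)) (a := a) (fun σ hσ => ((h.mem_iff σ).1 hσ).1)
    (fun σ hσ => ((h.mem_iff σ).1 hσ).2 i hi.le) (fun σ hσ => ((h.mem_iff σ).1 hσ).2 (i + 1) hi)
    (fun σ hσ τ hτ => by
      obtain ⟨hp, hq⟩ := (h.mem_iff σ).1 hσ
      refine (h.mem_iff _).2 ⟨hp.splice (hq i hi.le) (hq (i + 1) hi) hτ, fun k hk => ?_⟩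
      -- By monotonicity, a point of the chain inside the resampled rectangle coincides with one of
      -- its two corners, which every new segment contains.
      by_cases hm : f k ∈ Finset.Icc (f i) (f (i + 1))
      · refine Finset.mem_union_right _ ?_
        rw [Finset.mem_Icc] at hm
        have hle := h.mono (Nat.le_succ i)
        rcases Nat.lt_or_ge i k with hik | hik
        · rw [le_antisymm hm.2 (h.mono hik)]
          exact hτ.right_mem hle
        · rw [le_antisymm (h.mono hik) hm.1]
          exact hτ.left_mem hle
      · exact Finset.mem_union_left _ (Finset.mem_sdiff.2 ⟨hq k hk, hm⟩))
  have hlt := h.diag_lt i hi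
  have hs1 := h.slope_fst i hi
  have hs2 := h.slope_snd i hi
  generalize hfi : f i = u at *
  generalize hfi' : f (i + 1) = v at *
  obtain ⟨j, l, rfl⟩ := exists_eq_shift hua
  obtain ⟨j', l', rfl⟩ := exists_eq_shift hav
  have hv : shift (shift u j l) j' l' = shift u (j + j') (l + l') := by
    rw [Square.ext_iff]; simp only [shift_fst, shift_snd]; omega
  rw [hv] at hcount hs1 hs2 hlt
  rw [card_paths, card_paths, ← hv, card_paths] at hcount
  have hyp := hypergeometric_le (j := j) (l := l) (j' := j') (l' := l') hδ
    (by
      simp only [diag_shift, shift_fst] at hs1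
      push_cast at hs1 ⊢
      linarith)
    (by
      simp only [diag_shift, shift_snd] at hs2
      push_cast at hs2 ⊢
      linarith)
    (by simp only [diag_shift] at hlt; omega)
  set c3 : ℕ := ((j + j') + (l + l')).choose (j + j') with hc3
  have hc3pos : (0 : ℝ) < c3 := by
    rw [hc3]; exact_mod_cast Nat.choose_pos (by omega)
  -- Enlarging the sum from the two neighbouring points to the whole chain gives one formula valid
  -- on every antidiagonal.
  have hk1 : (√((j + l + 1 : ℕ) : ℝ))⁻¹ + (√((j' + l' + 1 : ℕ) : ℝ))⁻¹ ≤
      2 * ∑ k ∈ Finset.range (n + 1),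
        (√((Nat.dist (diag (shift u j l)) (diag (f k)) + 1 : ℕ) : ℝ))⁻¹ := by
    have hpos : ∀ k ∈ Finset.range (n + 1),
        0 ≤ (√((Nat.dist (diag (shift u j l)) (diag (f k)) + 1 : ℕ) : ℝ))⁻¹ :=
      fun _ _ => by positivity
    have e1 := Finset.single_le_sum hpos (Finset.mem_range.2 (show i < n + 1 by omega))
    have e2 := Finset.single_le_sum hpos (Finset.mem_range.2 (show i + 1 < n + 1 by omega))
    rw [hfi] at e1
    rw [hfi', hv] at e2
    have d1 : Nat.dist (diag (shift u j l)) (diag u) = j + l := by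
      rw [diag_shift]; unfold Nat.dist; omega
    have d2 : Nat.dist (diag (shift u j l)) (diag (shift u (j + j') (l + l'))) = j' + l' := by
      rw [diag_shift, diag_shift]; unfold Nat.dist; omega
    rw [d1] at e1
    rw [d2] at e2
    linarith
  have hcount' : ((S.filter (shift u j l ∈ ·)).card : ℝ) * c3 ≤
      S.card * (((j + l).choose j : ℝ) * (j' + l').choose j') := by
    exact_mod_cast hcount
  refine le_of_mul_le_mul_right ?_ hc3pos
  calc ((S.filter (shift u j l ∈ ·)).card : ℝ) * c3
      ≤ S.card * (((j + l).choose j : ℝ) * (j' + l').choose j') := hcount'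
    _ ≤ S.card * (4 / δ ^ 4 * ((√((j + l + 1 : ℕ) : ℝ))⁻¹ + (√((j' + l' + 1 : ℕ) : ℝ))⁻¹) * c3) := by
        gcongr
    _ ≤ S.card * (4 / δ ^ 4 * (2 * ∑ k ∈ Finset.range (n + 1),
        (√((Nat.dist (diag (shift u j l)) (diag (f k)) + 1 : ℕ) : ℝ))⁻¹) * c3) := by
        gcongr
    _ = hitBound δ n f (diag (shift u j l)) * S.card * c3 := by unfold hitBound; ring

theorem sum_hitBound_le (h : IsPathFamily δ n f S) :
    ∑ d ∈ Finset.range (diag (f n) + 1), hitBound δ n f d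
      ≤ 32 / δ ^ 4 * (n + 1) * √((diag (f n) + 1 : ℕ) : ℝ) := by
  have hδ := h.pos
  unfold hitBound
  rw [← Finset.mul_sum, Finset.sum_comm]
  have : ∑ i ∈ Finset.range (n + 1), ∑ d ∈ Finset.range (diag (f n) + 1),
      (√((Nat.dist d (diag (f i)) + 1 : ℕ) : ℝ))⁻¹
      ≤ ∑ i ∈ Finset.range (n + 1), 4 * √((diag (f n) + 1 : ℕ) : ℝ) := by
    refine Finset.sum_le_sum fun i hi => sum_inv_sqrt_dist_le ?_
    have := diag_mono (h.mono (Nat.lt_succ_iff.1 (Finset.mem_range.1 hi)))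
    omega
  rw [Finset.sum_const, Finset.card_range, nsmul_eq_mul] at this
  calc _ ≤ 8 / δ ^ 4 * (((n + 1 : ℕ) : ℝ) * (4 * √((diag (f n) + 1 : ℕ) : ℝ))) := by gcongr
    _ = _ := by push_cast; ring

/-- The expected overlap of two independent uniform paths through the chain is at most of the
order of the square root of the length of the paths. -/
theorem sum_sq_card_le (h : IsPathFamily δ n f S) (hn : 0 < n) [DecidableEq Square] :
    ∑ a ∈ S.biUnion id, ((S.filter (a ∈ ·)).card : ℝ) ^ 2
      ≤ 32 / δ ^ 4 * (n + 1) * √((diag (f n) + 1 : ℕ) : ℝ) * S.card ^ 2 := by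
  have hδ := h.pos
  have hnn : ∀ d, 0 ≤ hitBound δ n f d := fun d => by unfold hitBound; positivity
  -- Double counting: weighting a square by the number of paths through it amounts to summing along
  -- every path.
  have hsw : ∀ g : Square → ℝ, ∑ a ∈ S.biUnion id, ((S.filter (a ∈ ·)).card : ℝ) * g a
      = ∑ σ ∈ S, ∑ a ∈ σ, g a := by
    intro g
    have h1 : ∀ a, ((S.filter (a ∈ ·)).card : ℝ) * g a = ∑ σ ∈ S, if a ∈ σ then g a else 0 := by
      intro a
      rw [← Finset.sum_filter, Finset.sum_const, nsmul_eq_mul]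
    simp_rw [h1]
    rw [Finset.sum_comm]
    refine Finset.sum_congr rfl fun σ hσ => ?_
    rw [← Finset.sum_filter]
    congr 1
    ext a
    simp only [Finset.mem_filter, Finset.mem_biUnion, id]
    exact ⟨fun h => h.2, fun h => ⟨⟨σ, hσ, h⟩, h⟩⟩
  calc ∑ a ∈ S.biUnion id, ((S.filter (a ∈ ·)).card : ℝ) ^ 2
      ≤ ∑ a ∈ S.biUnion id, ((S.filter (a ∈ ·)).card : ℝ) *
          (hitBound δ n f (diag a) * S.card) := by
        refine Finset.sum_le_sum fun a _ => ?_
        rw [sq]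
        gcongr
        exact h.card_filter_mem_le hn a
    _ = ∑ σ ∈ S, ∑ a ∈ σ, hitBound δ n f (diag a) * S.card := hsw _
    _ ≤ ∑ σ ∈ S, (32 / δ ^ 4 * (n + 1) * √((diag (f n) + 1 : ℕ) : ℝ)) * S.card := by
        refine Finset.sum_le_sum fun σ hσ => ?_
        rw [← Finset.sum_mul]
        gcongr
        have hp := ((h.mem_iff σ).1 hσ).1
        -- The path meets each antidiagonal exactly once, so the sum along it no longer depends on
        -- the path.
        rw [hp.sum_diag (hitBound δ n f)]
        refine le_trans (Finset.sum_le_sum_of_subset_of_nonneg (fun d hd => ?_)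
          fun d _ _ => hnn d) h.sum_hitBound_le
        rw [Finset.mem_Icc] at hd
        rw [Finset.mem_range]
        omega
    _ = _ := by rw [Finset.sum_const, nsmul_eq_mul]; ring

end IsPathFamily


/-! ### A quantitative central limit theorem for characteristic functions. -/

/-- For `|x| ≤ 1` this is the exponential remainder with `e ≤ 4`; for `|x| > 1` each term is
dominated separately by a multiple of `|x| ^ 3`. -/
theorem norm_cexp_mul_I_sub_taylor_le (x : ℝ) :
    ‖Complex.exp (x * Complex.I) - (1 + x * Complex.I - (x : ℂ) ^ 2 / 2)‖ ≤ 4 * |x| ^ 3 := by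
  rcases le_or_gt |x| 1 with h | h
  · have h1 := Complex.norm_exp_sub_sum_le_norm_mul_exp (x * Complex.I) 3
    have h2 : ∑ m ∈ Finset.range 3, (x * Complex.I : ℂ) ^ m / (m.factorial : ℂ)
        = 1 + x * Complex.I - (x : ℂ) ^ 2 / 2 := by
      simp [Finset.sum_range_succ, Nat.factorial, mul_pow]
      ring
    rw [h2] at h1
    have h3 : ‖(x * Complex.I : ℂ)‖ = |x| := by simp
    rw [h3] at h1
    refine h1.trans ?_
    rw [mul_comm]
    gcongr
    calc Real.exp |x| ≤ Real.exp 1 := Real.exp_le_exp.2 h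
      _ ≤ 4 := by have := Real.exp_one_lt_d9; linarith
  · have h1 : ‖Complex.exp (x * Complex.I)‖ = 1 := Complex.norm_exp_ofReal_mul_I x
    have h2 : ‖(1 + x * Complex.I - (x : ℂ) ^ 2 / 2)‖ ≤ 1 + |x| + |x| ^ 2 / 2 := by
      refine (norm_sub_le _ _).trans (add_le_add ((norm_add_le _ _).trans ?_) ?_)
      · simp
      · simp
    have h4 : |x| ≤ |x| ^ 3 := by
      simpa using pow_le_pow_right₀ h.le (show 1 ≤ 3 by norm_num)
    have h5 : |x| ^ 2 ≤ |x| ^ 3 := pow_le_pow_right₀ h.le (by norm_num)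
    have := (norm_sub_le (Complex.exp (x * Complex.I)) (1 + x * Complex.I - (x : ℂ) ^ 2 / 2))
    linarith

theorem abs_exp_neg_sub_le {y : ℝ} (hy : 0 ≤ y) : |Real.exp (-y) - (1 - y)| ≤ y ^ 2 := by
  rcases le_or_gt y 1 with h | h
  · have := Real.abs_exp_sub_one_sub_id_le (x := -y) (by rwa [abs_neg, abs_of_nonneg hy])
    rw [neg_sq] at this
    convert this using 2
    ring
  · have h1 := Real.add_one_le_exp (-y)
    have h2 : Real.exp (-y) ≤ 1 := Real.exp_le_one_iff.2 (by linarith)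
    rw [abs_of_nonneg (by linarith)]
    nlinarith

/-- Factors are exchanged one at a time, and the remaining ones, of modulus at most 1, do not
amplify the error. -/
theorem norm_prod_sub_prod_le {ι : Type*} (s : Finset ι) (f g : ι → ℂ)
    (hf : ∀ i ∈ s, ‖f i‖ ≤ 1) (hg : ∀ i ∈ s, ‖g i‖ ≤ 1) :
    ‖∏ i ∈ s, f i - ∏ i ∈ s, g i‖ ≤ ∑ i ∈ s, ‖f i - g i‖ := by
  classical
  induction s using Finset.induction_on with
  | empty => simp
  | insert a s ha ih =>
    rw [Finset.prod_insert ha, Finset.prod_insert ha, Finset.sum_insert ha]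
    have h1 := ih (fun i hi => hf i (Finset.mem_insert_of_mem hi))
      (fun i hi => hg i (Finset.mem_insert_of_mem hi))
    have h2 : ‖∏ i ∈ s, f i‖ ≤ 1 := by
      rw [norm_prod]
      exact Finset.prod_le_one (fun _ _ => norm_nonneg _)
        fun i hi => hf i (Finset.mem_insert_of_mem hi)
    have h3 := hg a (Finset.mem_insert_self _ _)
    calc ‖f a * ∏ i ∈ s, f i - g a * ∏ i ∈ s, g i‖
        = ‖(f a - g a) * ∏ i ∈ s, f i + g a * (∏ i ∈ s, f i - ∏ i ∈ s, g i)‖ := by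
          congr 1; ring
      _ ≤ ‖f a - g a‖ * ‖∏ i ∈ s, f i‖ + ‖g a‖ * ‖∏ i ∈ s, f i - ∏ i ∈ s, g i‖ := by
          refine (norm_add_le _ _).trans ?_
          rw [norm_mul, norm_mul]
      _ ≤ ‖f a - g a‖ * 1 + 1 * ∑ i ∈ s, ‖f i - g i‖ := by gcongr
      _ = _ := by ring

section

variable {Ω : Type*} [MeasurableSpace Ω] {P : Measure Ω} [IsProbabilityMeasure P]

theorem norm_charFun_sub_taylor_le {X : Ω → ℝ} (hX : Measurable X) (h0 : ∫ ω, X ω ∂P = 0)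
    (h1 : ∫ ω, X ω ^ 2 ∂P = 1) {C : ℝ} (h3 : Integrable (fun ω => |X ω| ^ 3) P)
    (hC : ∫ ω, |X ω| ^ 3 ∂P ≤ C) (s : ℝ) :
    ‖charFun (P.map X) s - ((1 - s ^ 2 / 2 : ℝ) : ℂ)‖ ≤ 4 * |s| ^ 3 * C := by
  -- The integral of a non-integrable function is 0 by convention, so the value 1 forces
  -- integrability.
  have hi2 : Integrable (fun ω => X ω ^ 2) P := by
    by_contra h
    rw [integral_undef h] at h1
    norm_num at h1
  have hi1 : Integrable X P := by
    refine (hi2.add (integrable_const 1)).mono' hX.aestronglyMeasurable (ae_of_all _ fun ω => ?_)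
    rw [Real.norm_eq_abs, Pi.add_apply, ← sq_abs]
    nlinarith [sq_nonneg (|X ω| - 1)]
  have hexp : charFun (P.map X) s = ∫ ω, Complex.exp ((s * X ω : ℝ) * Complex.I) ∂P := by
    rw [charFun_apply_real, integral_map hX.aemeasurable (by fun_prop)]
    push_cast
    rfl
  have hei : Integrable (fun ω => Complex.exp ((s * X ω : ℝ) * Complex.I)) P := by
    refine Integrable.of_bound (C := 1) (by fun_prop) (ae_of_all _ fun ω => ?_)
    rw [Complex.norm_exp_ofReal_mul_I]
  have hti : Integrable (fun ω => 1 + ((s * X ω : ℝ) : ℂ) * Complex.I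
      - ((s * X ω : ℝ) : ℂ) ^ 2 / 2) P := by
    have e1 : Integrable (fun ω => ((s * X ω : ℝ) : ℂ) * Complex.I) P :=
      ((hi1.const_mul s).ofReal).mul_const _
    have e2 : Integrable (fun ω => ((s * X ω : ℝ) : ℂ) ^ 2 / 2) P := by
      have := ((hi2.const_mul (s ^ 2)).ofReal (𝕜 := ℂ)).div_const 2
      refine this.congr (ae_of_all _ fun ω => ?_)
      simp [mul_pow]
    exact ((integrable_const _).add e1).sub e2
  have htv : ∫ ω, (1 + ((s * X ω : ℝ) : ℂ) * Complex.I - ((s * X ω : ℝ) : ℂ) ^ 2 / 2) ∂P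
      = ((1 - s ^ 2 / 2 : ℝ) : ℂ) := by
    have e1 : Integrable (fun ω => ((s * X ω : ℝ) : ℂ) * Complex.I) P :=
      ((hi1.const_mul s).ofReal).mul_const _
    have e2 : ∀ ω, ((s * X ω : ℝ) : ℂ) ^ 2 / 2 = ((s ^ 2 / 2 * X ω ^ 2 : ℝ) : ℂ) := by
      intro ω; push_cast; ring
    simp_rw [e2]
    have e3 : Integrable (fun ω => ((s ^ 2 / 2 * X ω ^ 2 : ℝ) : ℂ)) P :=
      (hi2.const_mul (s ^ 2 / 2)).ofReal
    have e4 : Integrable (fun ω => 1 + ((s * X ω : ℝ) : ℂ) * Complex.I) P :=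
      (integrable_const _).add e1
    rw [integral_sub e4 e3, integral_add (integrable_const _) e1, integral_mul_const,
      integral_complex_ofReal, integral_complex_ofReal, integral_const_mul, integral_const_mul,
      h0, h1]
    simp
  rw [hexp, ← htv, ← integral_sub hei hti]
  calc _ ≤ ∫ ω, 4 * |s| ^ 3 * |X ω| ^ 3 ∂P := by
        refine norm_integral_le_of_norm_le (h3.const_mul _) (ae_of_all _ fun ω => ?_)
        have := norm_cexp_mul_I_sub_taylor_le (s * X ω)
        rwa [abs_mul, mul_pow, ← mul_assoc] at this
    _ = 4 * |s| ^ 3 * ∫ ω, |X ω| ^ 3 ∂P := integral_const_mul _ _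
    _ ≤ _ := by gcongr

/-- A quantitative central limit theorem at the level of characteristic functions. -/
theorem norm_charFun_sum_sub_le {ι : Type*} {w : ι → Ω → ℝ} (hw : ∀ a, Measurable (w a))
    (hind : iIndepFun w P) (h0 : ∀ a, ∫ ω, w a ω ∂P = 0) (h1 : ∀ a, ∫ ω, w a ω ^ 2 ∂P = 1)
    {C : ℝ} (h3 : ∀ a, Integrable (fun ω => |w a ω| ^ 3) P) (hC : ∀ a, ∫ ω, |w a ω| ^ 3 ∂P ≤ C)
    {σ : Finset ι} (hσ : 0 < σ.card) (t : ℝ) :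
    ‖charFun (P.map fun ω => (√(σ.card : ℝ))⁻¹ * ∑ a ∈ σ, w a ω) t
      - ((Real.exp (-t ^ 2 / 2) : ℝ) : ℂ)‖ ≤ (4 * |t| ^ 3 * C + t ^ 4) * (√(σ.card : ℝ))⁻¹ := by
  have hn1 : (1 : ℝ) ≤ σ.card := by exact_mod_cast hσ
  set n : ℝ := (σ.card : ℝ) with hn
  have hn0 : 0 < n := by linarith
  set r := (√n)⁻¹ with hr
  have hr0 : 0 < r := by rw [hr]; positivity
  have hr2 : n * r ^ 2 = 1 := by
    rw [hr, inv_pow, Real.sq_sqrt hn0.le]; field_simp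
  have hr1 : r ≤ 1 := by
    rw [hr]; exact inv_le_one_of_one_le₀ (Real.one_le_sqrt.2 hn1)
  have hsum : charFun (P.map fun ω => r * ∑ a ∈ σ, w a ω) t
      = ∏ a ∈ σ, charFun (P.map (w a)) (r * t) := by
    rw [charFun_map_mul_comp (Finset.aemeasurable_fun_sum _ fun a _ => (hw a).aemeasurable),
      (hind.restrict _).charFun_map_fun_finsetSum_eq_prod fun a _ => (hw a).aemeasurable,
      Finset.prod_apply]
  -- The Gaussian value is split into `σ.card` equal factors, to be compared with the characteristic
  -- functions of the single weights.
  have hgauss : ((Real.exp (-t ^ 2 / 2) : ℝ) : ℂ)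
      = ∏ _a ∈ σ, ((Real.exp (-((r * t) ^ 2 / 2)) : ℝ) : ℂ) := by
    rw [Finset.prod_const, ← Complex.ofReal_pow, ← Real.exp_nat_mul]
    congr 2
    rw [← hn]
    linear_combination (t ^ 2 / 2) * hr2
  have hterm : ∀ a, ‖charFun (P.map (w a)) (r * t) - ((Real.exp (-((r * t) ^ 2 / 2)) : ℝ) : ℂ)‖
      ≤ 4 * |r * t| ^ 3 * C + ((r * t) ^ 2 / 2) ^ 2 := by
    intro a
    have e1 := norm_charFun_sub_taylor_le (hw a) (h0 a) (h1 a) (h3 a) (hC a) (r * t)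
    have e2 := abs_exp_neg_sub_le (y := (r * t) ^ 2 / 2) (by positivity)
    have e3 : ‖((1 - (r * t) ^ 2 / 2 : ℝ) : ℂ) - ((Real.exp (-((r * t) ^ 2 / 2)) : ℝ) : ℂ)‖
        ≤ ((r * t) ^ 2 / 2) ^ 2 := by
      rw [← Complex.ofReal_sub, Complex.norm_real, Real.norm_eq_abs, abs_sub_comm]
      exact e2
    exact (norm_sub_le_norm_sub_add_norm_sub _ _ _).trans (add_le_add e1 e3)
  rw [hsum, hgauss]
  refine (norm_prod_sub_prod_le σ _ _ (fun a _ => ?_) fun a _ => ?_).trans ?_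
  · have := Measure.isProbabilityMeasure_map (μ := P) (hw a).aemeasurable
    exact norm_charFun_le_one _
  · rw [Complex.norm_real, Real.norm_eq_abs, Real.abs_exp, Real.exp_le_one_iff]
    have : 0 ≤ (r * t) ^ 2 / 2 := by positivity
    linarith
  refine (Finset.sum_le_sum fun a _ => hterm a).trans ?_
  rw [Finset.sum_const, nsmul_eq_mul, ← hn, abs_mul, abs_of_pos hr0]
  have : n * (4 * (r * |t|) ^ 3 * C + ((r * t) ^ 2 / 2) ^ 2)
      = (n * r ^ 2) * (4 * |t| ^ 3 * C * r + t ^ 4 * r ^ 2 / 4) := by ring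
  rw [this, hr2, one_mul]
  have : t ^ 4 * r ^ 2 / 4 ≤ t ^ 4 * r := by
    have ht : 0 ≤ t ^ 4 := by positivity
    have : r ^ 2 / 4 ≤ r := by nlinarith
    calc t ^ 4 * r ^ 2 / 4 = t ^ 4 * (r ^ 2 / 4) := by ring
      _ ≤ _ := by gcongr
  linarith

/-- Passing to real test functions makes the concentration bounds for real Lipschitz functions
applicable. -/
theorem charFun_map_eq_cos_add_sin {Y : Ω → ℝ} (hY : Measurable Y) (t : ℝ) :
    charFun (P.map Y) t
      = ((∫ ω, Real.cos (t * Y ω) ∂P : ℝ) : ℂ) + (∫ ω, Real.sin (t * Y ω) ∂P : ℝ) * Complex.I := by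
  rw [charFun_apply_real, integral_map hY.aemeasurable (by fun_prop),
    ← integral_complex_ofReal, ← integral_complex_ofReal, ← integral_mul_const, ← integral_add]
  · refine integral_congr_ae (ae_of_all _ fun ω => ?_)
    simp only
    rw [← Complex.ofReal_mul, Complex.exp_mul_I]
    simp
  · refine (Integrable.of_bound (C := 1)
      (Real.measurable_cos.comp (hY.const_mul t)).aestronglyMeasurable
      (ae_of_all _ fun ω => ?_)).ofReal
    exact Real.abs_cos_le_one _
  · refine (Integrable.of_bound (C := 1)
      (Real.measurable_sin.comp (hY.const_mul t)).aestronglyMeasurable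
      (ae_of_all _ fun ω => ?_)).ofReal.mul_const _
    exact Real.abs_sin_le_one _

theorem abs_integral_cos_sub_le {Y : Ω → ℝ} (hY : Measurable Y) {t c C : ℝ}
    (h : ‖charFun (P.map Y) t - (c : ℂ)‖ ≤ C) : |∫ ω, Real.cos (t * Y ω) ∂P - c| ≤ C := by
  rw [charFun_map_eq_cos_add_sin hY] at h
  refine le_trans ?_ ((Complex.abs_re_le_norm _).trans h)
  simp

theorem abs_integral_sin_le {Y : Ω → ℝ} (hY : Measurable Y) {t c C : ℝ}
    (h : ‖charFun (P.map Y) t - (c : ℂ)‖ ≤ C) : |∫ ω, Real.sin (t * Y ω) ∂P| ≤ C := by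
  rw [charFun_map_eq_cos_add_sin hY] at h
  refine le_trans ?_ ((Complex.abs_im_le_norm _).trans h)
  simp

end


/-! ### Truncation, averages over path families, and concentration. -/

/-- Truncation of a real number at height `b`. -/
def clamp (b : ℝ≥0) (x : ℝ) : ℝ := max (-(b : ℝ)) (min b x)

theorem measurable_clamp (b : ℝ≥0) : Measurable (clamp b) := by
  unfold clamp; fun_prop

theorem abs_clamp_le (b : ℝ≥0) (x : ℝ) : |clamp b x| ≤ b := by
  have := b.coe_nonneg
  rw [abs_le, clamp]
  exact ⟨le_max_left _ _, max_le (by linarith) (min_le_left _ _)⟩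

theorem abs_sub_clamp_le (b : ℝ≥0) (x : ℝ) : |x - clamp b x| ≤ |x| := by
  have := b.coe_nonneg
  unfold clamp
  rcases max_cases (-(b : ℝ)) (min b x) with h | h <;> rcases min_cases (b : ℝ) x with h' | h' <;>
    rw [h.1] <;> cases abs_cases x <;> cases abs_cases (x - (-(b : ℝ))) <;>
    cases abs_cases (x - min (b : ℝ) x) <;> grind

theorem clamp_eq_self {b : ℝ≥0} {x : ℝ} (h : |x| ≤ b) : clamp b x = x := by
  rw [abs_le] at h
  rw [clamp, min_eq_right h.2, max_eq_right h.1]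

/-- Truncation acts only where `|x| > b`, and there `|x| ^ (1 - p) ≤ b ^ (1 - p)`. Integrated, this
bounds the truncation error by the `p`-th moment. -/
theorem abs_sub_clamp_le_rpow {b : ℝ≥0} (hb : 0 < b) {p : ℝ} (hp : 1 ≤ p) (x : ℝ) :
    |x - clamp b x| ≤ (b : ℝ) ^ (1 - p) * |x| ^ p := by
  have hb' : (0 : ℝ) < b := hb
  rcases le_or_gt |x| b with h | h
  · rw [clamp_eq_self h, sub_self, abs_zero]; positivity
  · refine (abs_sub_clamp_le b x).trans ?_
    have hx : 0 < |x| := hb'.trans h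
    calc |x| = |x| ^ (1 - p) * |x| ^ p := by rw [← Real.rpow_add hx]; simp
      _ ≤ (b : ℝ) ^ (1 - p) * |x| ^ p := by
        gcongr ?_ * _
        exact Real.rpow_le_rpow_of_nonpos hb' h.le (by linarith)

/-- The mean of `g` over a finite set. -/
noncomputable def avg {κ : Type*} (S : Finset κ) (g : κ → ℝ) : ℝ := (∑ σ ∈ S, g σ) / S.card

theorem avg_mono {κ : Type*} {S : Finset κ} {g h : κ → ℝ} (hgh : ∀ σ ∈ S, g σ ≤ h σ) :
    avg S g ≤ avg S h := by
  unfold avg; gcongr with σ hσ; exact hgh σ hσ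

/-- The sign condition covers the empty set, whose average is 0. -/
theorem avg_le {κ : Type*} {S : Finset κ} {g : κ → ℝ} {C : ℝ} (hC : 0 ≤ C)
    (h : ∀ σ ∈ S, g σ ≤ C) : avg S g ≤ C := by
  refine div_le_of_le_mul₀ (Nat.cast_nonneg _) hC ?_
  have := Finset.sum_le_card_nsmul S g C h
  rw [nsmul_eq_mul] at this
  linarith

theorem abs_avg_le {κ : Type*} {S : Finset κ} {g : κ → ℝ} : |avg S g| ≤ avg S fun σ => |g σ| := by
  unfold avg
  rw [abs_div, Nat.abs_cast]
  gcongr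
  exact Finset.abs_sum_le_sum_abs _ _

theorem avg_sub {κ : Type*} (S : Finset κ) (g h : κ → ℝ) :
    avg S g - avg S h = avg S fun σ => g σ - h σ := by
  unfold avg; rw [Finset.sum_sub_distrib, sub_div]

theorem avg_const {κ : Type*} {S : Finset κ} (hS : S.Nonempty) (c : ℝ) :
    avg S (fun _ => c) = c := by
  have : (S.card : ℝ) ≠ 0 := by exact_mod_cast hS.card_pos.ne'
  unfold avg; rw [Finset.sum_const, nsmul_eq_mul]; field_simp

section

variable {ι : Type*} {Ω : Type*} [MeasurableSpace Ω] {P : Measure Ω} [IsProbabilityMeasure P]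

/-- The mean over `S` of `f` evaluated at the normalised sums of the weights. -/
noncomputable def meanSum (f : ℝ → ℝ) (r : ℝ) (S : Finset (Finset ι)) (x : ι → ℝ) : ℝ :=
  avg S fun σ => f (r * ∑ a ∈ σ, x a)

theorem measurable_meanSum {f : ℝ → ℝ} (hf : Measurable f) (r : ℝ) (S : Finset (Finset ι)) :
    Measurable (meanSum f r S) := by
  unfold meanSum avg
  refine Measurable.div_const (Finset.measurable_fun_sum _ fun σ _ => hf.comp ?_) _
  fun_prop

theorem abs_meanSum_sub_le {f : ℝ → ℝ} {L : ℝ≥0} (hf : LipschitzWith L f) {r : ℝ} (hr : 0 ≤ r)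
    (S : Finset (Finset ι)) (x y : ι → ℝ) :
    |meanSum f r S x - meanSum f r S y| ≤ avg S fun σ => L * r * |∑ a ∈ σ, (x a - y a)| := by
  unfold meanSum
  rw [avg_sub]
  refine abs_avg_le.trans (avg_mono fun σ _ => ?_)
  have := hf.dist_le_mul (r * ∑ a ∈ σ, x a) (r * ∑ a ∈ σ, y a)
  rw [Real.dist_eq, Real.dist_eq, ← mul_sub, ← Finset.sum_sub_distrib, abs_mul,
    abs_of_nonneg hr] at this
  linarith

/-- Concentration of the mean over a family of finsets, in terms of the overlap of the family. -/
theorem meanSum_concentration [DecidableEq ι] {w : ι → Ω → ℝ} (hw : ∀ a, Measurable (w a))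
    (hind : iIndepFun w P) (B : ι → ℝ≥0) {f : ℝ → ℝ} {L : ℝ≥0} (hf : LipschitzWith L f)
    {r : ℝ} (hr : 0 ≤ r) (S : Finset (Finset ι)) {V : ℝ≥0}
    (hV : ∑ a ∈ S.biUnion id, ((2 * L * r) * (B a * (S.filter (a ∈ ·)).card / S.card)) ^ 2 ≤ (V : ℝ))
    {ε : ℝ} (hε : 0 ≤ ε) :
    P.real {ω | ε ≤ |meanSum f r S (fun a => clamp (B a) (w a ω))
      - ∫ ω', meanSum f r S (fun a => clamp (B a) (w a ω')) ∂P|} ≤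
      2 * Real.exp (-ε ^ 2 / (2 * V)) := by
  set F : (ι → ℝ) → ℝ := fun x => meanSum f r S fun a => clamp (B a) (x a) with hF
  have hFm : Measurable F := (measurable_meanSum hf.continuous.measurable r S).comp
    (measurable_pi_iff.2 fun a => (measurable_clamp _).comp (measurable_pi_apply a))
  have hFs : ∀ x y, (∀ a ∈ S.biUnion id, x a = y a) → F x = F y := by
    intro x y hxy
    simp only [hF, meanSum, avg]
    congr 1
    refine Finset.sum_congr rfl fun σ hσ => ?_
    congr 2
    refine Finset.sum_congr rfl fun a ha => ?_
    rw [hxy a (Finset.mem_biUnion.2 ⟨σ, hσ, ha⟩)]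
  have hFb : ∀ x, |F x| ≤ |f 0| + L * r * ∑ a ∈ S.biUnion id, (B a : ℝ) := by
    intro x
    have hnn : 0 ≤ |f 0| + L * r * ∑ a ∈ S.biUnion id, (B a : ℝ) := by
      have : 0 ≤ ∑ a ∈ S.biUnion id, (B a : ℝ) := Finset.sum_nonneg fun _ _ => NNReal.coe_nonneg _
      positivity
    refine abs_avg_le.trans (avg_le hnn fun σ hσ => ?_)
    have h1 := hf.dist_le_mul (r * ∑ a ∈ σ, clamp (B a) (x a)) 0
    rw [Real.dist_eq, Real.dist_eq, sub_zero, abs_mul, abs_of_nonneg hr] at h1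
    have h2 : |∑ a ∈ σ, clamp (B a) (x a)| ≤ ∑ a ∈ S.biUnion id, (B a : ℝ) := by
      refine (Finset.abs_sum_le_sum_abs _ _).trans
        ((Finset.sum_le_sum fun a _ => abs_clamp_le _ _).trans ?_)
      exact Finset.sum_le_sum_of_subset_of_nonneg
        (fun a ha => Finset.mem_biUnion.2 ⟨σ, hσ, ha⟩) fun _ _ _ => NNReal.coe_nonneg _
    have h3 := abs_sub_abs_le_abs_sub (f (r * ∑ a ∈ σ, clamp (B a) (x a))) (f 0)
    have h4 : L * (r * |∑ a ∈ σ, clamp (B a) (x a)|)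
        ≤ L * r * ∑ a ∈ S.biUnion id, (B a : ℝ) := by
      rw [← mul_assoc]; gcongr
    linarith
  -- Changing coordinate `a` moves its clamped value by at most `2 * B a`, and only the members of
  -- `S` containing `a` notice.
  set c : ι → ℝ≥0 := fun a =>
    ⟨(2 * L * r) * (B a * (S.filter (a ∈ ·)).card / S.card), by positivity⟩ with hc
  have hcv : ∀ a, (c a : ℝ) = (2 * L * r) * (B a * (S.filter (a ∈ ·)).card / S.card) :=
    fun _ => rfl
  have hFd : ∀ x, ∀ a ∈ S.biUnion id, ∀ y, |F (Function.update x a y) - F x| ≤ c a := by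
    intro x a _ y
    refine (abs_meanSum_sub_le hf hr S _ _).trans ?_
    have h1 : ∀ σ ∈ S, L * r * |∑ b ∈ σ, (clamp (B b) (Function.update x a y b) - clamp (B b) (x b))|
        ≤ if a ∈ σ then L * r * (2 * B a) else 0 := by
      intro σ _
      have h2 : ∀ b ≠ a, clamp (B b) (Function.update x a y b) - clamp (B b) (x b) = 0 := by
        intro b hb; rw [Function.update_of_ne hb, sub_self]
      split_ifs with ha
      · rw [Finset.sum_eq_single_of_mem a ha fun b _ hb => h2 b hb]
        gcongr
        have e1 := abs_le.1 (abs_clamp_le (B a) (Function.update x a y a))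
        have e2 := abs_le.1 (abs_clamp_le (B a) (x a))
        rw [abs_le]
        constructor <;> linarith
      · rw [Finset.sum_eq_zero fun b hb => h2 b fun h => ha (h ▸ hb)]
        simp
    refine (avg_mono h1).trans (le_of_eq ?_)
    rw [hcv, avg, ← Finset.sum_filter, Finset.sum_const, nsmul_eq_mul]
    ring
  have key := hasSubgaussianMGF_of_bounded_differences hw hind (S.biUnion id) hFm hFs hFb hFd
  have key' : HasSubgaussianMGF (fun ω => F (fun a => w a ω) - ∫ ω', F (fun a => w a ω') ∂P) V P := by
    refine ⟨key.integrable_exp_mul, fun t => (key.mgf_le t).trans ?_⟩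
    rw [Real.exp_le_exp]
    gcongr
    rw [← NNReal.coe_le_coe]
    push_cast
    simp only [hcv]
    exact hV
  have h1 := key'.measure_ge_le hε
  have h2 := key'.neg.measure_ge_le hε
  calc _ ≤ P.real ({ω | ε ≤ F (fun a => w a ω) - ∫ ω', F (fun a => w a ω') ∂P} ∪
        {ω | ε ≤ (-fun ω => F (fun a => w a ω) - ∫ ω', F (fun a => w a ω') ∂P) ω}) := by
        refine measureReal_mono fun ω hω => ?_
        rcases le_abs.1 (show ε ≤ |_| from hω) with h | h
        · exact Or.inl h
        · exact Or.inr h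
    _ ≤ _ := (measureReal_union_le _ _).trans (by linarith)

theorem summable_exp_neg_rpow {c : ℝ} (hc : 0 < c) {s : ℝ} (hs : 0 < s) :
    Summable fun N : ℕ => Real.exp (-c * (N : ℝ) ^ s) := by
  -- The exponent `-2 / s` turns powers of `N ^ s` into the summable `N ^ (-2)`.
  have h1 := isLittleO_exp_neg_mul_rpow_atTop hc (-2 / s)
  have h2 : Tendsto (fun N : ℕ => (N : ℝ) ^ s) atTop atTop :=
    (tendsto_rpow_atTop hs).comp tendsto_natCast_atTop_atTop
  have h3 := (h1.comp_tendsto h2).isBigO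
  refine summable_of_isBigO_nat (g := fun N : ℕ => (N : ℝ) ^ (-2 : ℝ))
    (Real.summable_nat_rpow.2 (by norm_num)) (h3.trans (Asymptotics.IsBigO.of_bound 1 ?_))
  refine Eventually.of_forall fun N => ?_
  simp only [Function.comp, one_mul]
  rw [← Real.rpow_mul (Nat.cast_nonneg N)]
  have : s * (-2 / s) = -2 := by field_simp
  rw [this]

/-- Borel–Cantelli for each threshold `1 / (k + 1)`, followed by a countable intersection over `k`.
-/
theorem ae_tendsto_zero_of_tail {G : ℕ → Ω → ℝ}
    (h : ∀ ε > 0, ∃ c > 0, ∃ s > 0, ∀ᶠ N : ℕ in atTop,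
      P.real {ω | ε ≤ |G N ω|} ≤ 2 * Real.exp (-c * (N : ℝ) ^ (s : ℝ))) :
    ∀ᵐ ω ∂P, Tendsto (fun N => G N ω) atTop (𝓝 0) := by
  have key : ∀ k : ℕ, ∀ᵐ ω ∂P, ∀ᶠ N in atTop, |G N ω| < 1 / ((k : ℝ) + 1) := by
    intro k
    obtain ⟨c, hc, s, hs, hev⟩ := h (1 / ((k : ℝ) + 1)) (by positivity)
    obtain ⟨N₀, hN₀⟩ := eventually_atTop.1 hev
    have hsum : Summable fun N : ℕ => P.real {ω | 1 / ((k : ℝ) + 1) ≤ |G (N + N₀) ω|} := by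
      refine Summable.of_nonneg_of_le (fun _ => measureReal_nonneg) (fun N => hN₀ (N + N₀) (by omega))
        ?_
      exact (summable_nat_add_iff (f := fun N : ℕ => 2 * Real.exp (-c * (N : ℝ) ^ s)) N₀).2
        ((summable_exp_neg_rpow hc hs).mul_left 2)
    have hfin : ∑' N, P {ω | 1 / ((k : ℝ) + 1) ≤ |G (N + N₀) ω|} ≠ ⊤ := by
      have := hsum.tsum_ofReal_ne_top
      simpa [ofReal_measureReal] using this
    filter_upwards [ae_eventually_notMem hfin] with ω hω
    rw [eventually_atTop] at hω ⊢
    obtain ⟨N₁, hN₁⟩ := hω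
    refine ⟨N₁ + N₀, fun N hN => ?_⟩
    have := hN₁ (N - N₀) (by omega)
    rw [Nat.sub_add_cancel (by omega)] at this
    simpa using this
  filter_upwards [ae_all_iff.2 key] with ω hω
  rw [Metric.tendsto_atTop']
  intro ε hε
  obtain ⟨k, hk⟩ := exists_nat_one_div_lt hε
  obtain ⟨N₀, hN₀⟩ := eventually_atTop.1 (hω k)
  refine ⟨N₀, fun N hN => ?_⟩
  rw [Real.dist_eq, sub_zero]
  exact (hN₀ N hN.le).trans hk

end


/-! ### Removing the truncation, and the quenched limit theorem. -/

theorem integrable_avg {κ Ω : Type*} [MeasurableSpace Ω] {P : Measure Ω} (S : Finset κ) {g : κ → Ω → ℝ}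
    (hg : ∀ σ, Integrable (g σ) P) : Integrable (fun ω => avg S fun σ => g σ ω) P := by
  unfold avg
  exact (integrable_finsetSum _ fun σ _ => hg σ).div_const _

theorem integral_avg {κ Ω : Type*} [MeasurableSpace Ω] {P : Measure Ω} (S : Finset κ) {g : κ → Ω → ℝ}
    (hg : ∀ σ, Integrable (g σ) P) :
    ∫ ω, avg S (fun σ => g σ ω) ∂P = avg S fun σ => ∫ ω, g σ ω ∂P := by
  unfold avg
  rw [integral_div, integral_finsetSum _ fun σ _ => hg σ]

section

variable {ι : Type*} {Ω : Type*} [MeasurableSpace Ω] {P : Measure Ω} [IsProbabilityMeasure P]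

theorem integrable_lipschitz_comp {f : ℝ → ℝ} {L : ℝ≥0} (hf : LipschitzWith L f) {Y : Ω → ℝ}
    (hY : Integrable Y P) : Integrable (fun ω => f (Y ω)) P := by
  refine ((integrable_const |f 0|).add (hY.abs.const_mul (L : ℝ))).mono'
    (hf.continuous.comp_aestronglyMeasurable hY.aestronglyMeasurable) (ae_of_all _ fun ω => ?_)
  have h1 := hf.dist_le_mul (Y ω) 0
  rw [Real.dist_eq, Real.dist_eq, sub_zero] at h1
  have h3 := abs_sub_abs_le_abs_sub (f (Y ω)) (f 0)
  rw [Real.norm_eq_abs, Pi.add_apply]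
  linarith

/-- If the overlaps are small, then the mean over `S N` of a Lipschitz function of the normalised
sums of the weights concentrates around its expectation. -/
theorem ae_tendsto_meanSum_sub [Countable ι] [DecidableEq ι] {w : ι → Ω → ℝ}
    (hw : ∀ a, Measurable (w a)) (hind : iIndepFun w P) (hint : ∀ a, Integrable (w a) P)
    (B : ι → ℝ≥0) {ρ : ι → ℝ} (hρ : Summable ρ)
    (hB : ∀ a, ∫ ω, |w a ω - clamp (B a) (w a ω)| ∂P ≤ ρ a) {S : ℕ → Finset (Finset ι)}
    {n : ℕ → ℕ} (hn : ∀ᶠ N in atTop, N ≤ n N) {C s : ℝ} (hC : 0 < C) (hs : 0 < s)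
    (hS : ∀ᶠ N in atTop, ∑ a ∈ (S N).biUnion id,
      ((B a : ℝ) * ((S N).filter (a ∈ ·)).card / (S N).card) ^ 2 ≤ C * n N * (N : ℝ) ^ (-s))
    {f : ℝ → ℝ} {L : ℝ≥0} (hf : LipschitzWith L f) (hL : 0 < L) :
    ∀ᵐ ω ∂P, Tendsto (fun N => meanSum f (√(n N : ℝ))⁻¹ (S N) (fun a => w a ω)
      - avg (S N) fun σ => ∫ ω', f ((√(n N : ℝ))⁻¹ * ∑ a ∈ σ, w a ω') ∂P) atTop (𝓝 0) := by
  set r : ℕ → ℝ := fun N => (√(n N : ℝ))⁻¹ with hr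
  have hr0 : ∀ N, 0 ≤ r N := fun N => by positivity
  have hntop : Tendsto (fun N => (n N : ℝ)) atTop atTop :=
    tendsto_natCast_atTop_atTop.comp (tendsto_atTop_mono' _ hn tendsto_id)
  have hrtend : Tendsto r atTop (𝓝 0) :=
    tendsto_inv_atTop_zero.comp (Real.tendsto_sqrt_atTop.comp hntop)
  have hDint : ∀ a, Integrable (fun ω => |w a ω - clamp (B a) (w a ω)|) P := by
    intro a
    refine (hint a).abs.mono' ?_ (ae_of_all _ fun ω => ?_)
    · exact (((hw a).sub ((measurable_clamp _).comp (hw a))).abs).aestronglyMeasurable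
    · rw [Real.norm_eq_abs, abs_abs]
      exact abs_sub_clamp_le _ _
  have hclint : ∀ a, Integrable (fun ω => clamp (B a) (w a ω)) P := fun a =>
    Integrable.of_bound (C := B a) ((measurable_clamp _).comp (hw a)).aestronglyMeasurable
      (ae_of_all _ fun ω => abs_clamp_le _ _)
  have hρ0 : ∀ a, 0 ≤ ρ a := fun a => (integral_nonneg fun _ => abs_nonneg _).trans (hB a)
  -- For the truncated weights, `r N ^ 2` cancels the factor `n N` of the overlap bound, which
  -- leaves a variance proxy of order `N ^ (-s)`.
  have hconc : ∀ᵐ ω ∂P, Tendsto (fun N => meanSum f (r N) (S N) (fun a => clamp (B a) (w a ω))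
      - ∫ ω', meanSum f (r N) (S N) (fun a => clamp (B a) (w a ω')) ∂P) atTop (𝓝 0) := by
    refine ae_tendsto_zero_of_tail fun ε hε => ?_
    have hL' : (0 : ℝ) < L := hL
    refine ⟨ε ^ 2 / (8 * L ^ 2 * C), by positivity, s, hs, ?_⟩
    filter_upwards [hS, hn, eventually_gt_atTop 0] with N hSN hnN hN
    have hn0 : (0 : ℝ) < n N := by exact_mod_cast hN.trans_le hnN
    have hN0 : (0 : ℝ) < N := by exact_mod_cast hN
    have hr2 : r N ^ 2 * n N = 1 := by
      rw [hr]; simp only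
      rw [inv_pow, Real.sq_sqrt hn0.le, inv_mul_cancel₀ hn0.ne']
    have hV := Real.coe_toNNReal (4 * L ^ 2 * C * (N : ℝ) ^ (-s)) (by positivity)
    refine (meanSum_concentration hw hind B hf (hr0 N) (S N)
      (V := (4 * L ^ 2 * C * (N : ℝ) ^ (-s)).toNNReal) ?_ hε.le).trans (le_of_eq ?_)
    · simp_rw [mul_pow (2 * (L : ℝ) * r N)]
      rw [← Finset.mul_sum]
      calc _ ≤ (2 * L * r N) ^ 2 * (C * n N * (N : ℝ) ^ (-s)) := by gcongr
        _ = 4 * L ^ 2 * C * (N : ℝ) ^ (-s) * (r N ^ 2 * n N) := by ring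
        _ = _ := by rw [hr2, mul_one, hV]
    · congr 2
      rw [hV, Real.rpow_neg hN0.le]
      have : (N : ℝ) ^ s ≠ 0 := (Real.rpow_pos_of_pos hN0 s).ne'
      field_simp
      norm_num
  -- By Tonelli the truncation errors have finite expected total over all indices, so their total is
  -- almost surely finite.
  have hsumm : ∀ᵐ ω ∂P, Summable fun a => |w a ω - clamp (B a) (w a ω)| := by
    have h1 : ∫⁻ ω, ∑' a, ENNReal.ofReal |w a ω - clamp (B a) (w a ω)| ∂P ≠ ⊤ := by
      rw [lintegral_tsum fun a => (hDint a).aemeasurable.ennreal_ofReal]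
      refine ne_top_of_le_ne_top hρ.tsum_ofReal_ne_top (ENNReal.tsum_le_tsum fun a => ?_)
      rw [← ofReal_integral_eq_lintegral_ofReal (hDint a) (ae_of_all _ fun _ => abs_nonneg _)]
      exact ENNReal.ofReal_le_ofReal (hB a)
    have h2 := ae_lt_top' (AEMeasurable.tsum fun a =>
      (hDint a).aemeasurable.ennreal_ofReal) h1
    filter_upwards [h2] with ω hω
    have := ENNReal.summable_toReal hω.ne
    refine this.congr fun a => ?_
    rw [ENNReal.toReal_ofReal (abs_nonneg _)]
  have hmean : Tendsto (fun N => (avg (S N) fun σ => ∫ ω', f (r N * ∑ a ∈ σ, w a ω') ∂P)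
      - ∫ ω', meanSum f (r N) (S N) (fun a => clamp (B a) (w a ω')) ∂P) atTop (𝓝 0) := by
    have hlim : Tendsto (fun N => L * r N * ∑' a, ρ a) atTop (𝓝 0) := by
      simpa using (hrtend.const_mul (L : ℝ)).mul_const (∑' a, ρ a)
    refine squeeze_zero_norm (fun N => ?_) hlim
    have hi1 : ∀ σ : Finset ι, Integrable (fun ω => f (r N * ∑ a ∈ σ, w a ω)) P := fun σ =>
      integrable_lipschitz_comp hf ((integrable_finsetSum _ fun a _ => hint a).const_mul _)
    have hi2 : ∀ σ : Finset ι, Integrable (fun ω => f (r N * ∑ a ∈ σ, clamp (B a) (w a ω))) P :=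
      fun σ => integrable_lipschitz_comp hf
        ((integrable_finsetSum _ fun a _ => hclint a).const_mul _)
    have e1 := integral_avg (S N) hi1
    have j1 := integrable_avg (S N) hi1
    have j2 := integrable_avg (S N) hi2
    have hi3 : ∀ σ : Finset ι,
        Integrable (fun ω => L * r N * |∑ a ∈ σ, (w a ω - clamp (B a) (w a ω))|) P := fun σ =>
      ((integrable_finsetSum _ fun a _ => (hint a).sub (hclint a)).abs).const_mul _
    rw [← e1]
    unfold meanSum
    rw [← integral_sub j1 j2]
    calc _ ≤ ∫ ω, avg (S N) (fun σ => L * r N * |∑ a ∈ σ, (w a ω - clamp (B a) (w a ω))|) ∂P :=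
          norm_integral_le_of_norm_le (integrable_avg _ hi3) (ae_of_all _ fun ω =>
            abs_meanSum_sub_le hf (hr0 N) (S N) (fun a => w a ω) fun a => clamp (B a) (w a ω))
      _ = avg (S N) fun σ => ∫ ω, L * r N * |∑ a ∈ σ, (w a ω - clamp (B a) (w a ω))| ∂P :=
          integral_avg _ hi3
      _ ≤ _ := by
          refine avg_le (mul_nonneg (mul_nonneg L.coe_nonneg (hr0 N)) (tsum_nonneg hρ0))
            fun σ _ => ?_
          rw [integral_const_mul]
          gcongr
          calc ∫ ω, |∑ a ∈ σ, (w a ω - clamp (B a) (w a ω))| ∂P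
              ≤ ∫ ω, ∑ a ∈ σ, |w a ω - clamp (B a) (w a ω)| ∂P :=
                integral_mono (integrable_finsetSum _ fun a _ => (hint a).sub (hclint a)).abs
                  (integrable_finsetSum _ fun a _ => hDint a)
                  fun ω => Finset.abs_sum_le_sum_abs _ _
            _ = ∑ a ∈ σ, ∫ ω, |w a ω - clamp (B a) (w a ω)| ∂P :=
                integral_finsetSum _ fun a _ => hDint a
            _ ≤ ∑ a ∈ σ, ρ a := Finset.sum_le_sum fun a _ => hB a
            _ ≤ ∑' a, ρ a := hρ.sum_le_tsum _ fun a _ => hρ0 a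
  filter_upwards [hconc, hsumm] with ω h1 h2
  -- The total truncation error bounds the error along every `σ`, uniformly in `N`, and the factor
  -- `r N` sends it to 0.
  have h3 : Tendsto (fun N => meanSum f (r N) (S N) (fun a => w a ω)
      - meanSum f (r N) (S N) (fun a => clamp (B a) (w a ω))) atTop (𝓝 0) := by
    have hlim : Tendsto (fun N => L * r N * ∑' a, |w a ω - clamp (B a) (w a ω)|) atTop (𝓝 0) := by
      simpa using (hrtend.const_mul (L : ℝ)).mul_const (∑' a, |w a ω - clamp (B a) (w a ω)|)
    refine squeeze_zero_norm (fun N => ?_) hlim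
    refine (abs_meanSum_sub_le hf (hr0 N) (S N) _ _).trans
      (avg_le (mul_nonneg (mul_nonneg L.coe_nonneg (hr0 N)) (tsum_nonneg fun _ => abs_nonneg _))
        fun σ _ => ?_)
    gcongr
    exact (Finset.abs_sum_le_sum_abs _ _).trans (h2.sum_le_tsum _ fun a _ => abs_nonneg _)
  have h4 := (h3.add h1).sub hmean
  simp only [add_zero, sub_zero] at h4
  refine h4.congr fun N => ?_
  ring

/-- From `|y| ≤ (1 + y ^ 2) / 2` and unit variance. It controls the Lipschitz constant in the
frequency variable. -/
theorem integral_abs_normalized_sum_le_one {w : ι → Ω → ℝ} (hw : ∀ a, Measurable (w a))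
    (hind : iIndepFun w P) (h0 : ∀ a, ∫ ω, w a ω ∂P = 0) (h1 : ∀ a, ∫ ω, w a ω ^ 2 ∂P = 1)
    {σ : Finset ι} (hσ : 0 < σ.card) :
    ∫ ω, |(√(σ.card : ℝ))⁻¹ * ∑ a ∈ σ, w a ω| ∂P ≤ 1 := by
  have hL2 : ∀ a, MemLp (w a) 2 P := by
    intro a
    refine (memLp_two_iff_integrable_sq (hw a).aestronglyMeasurable).2 ?_
    by_contra h
    have := h1 a
    rw [integral_undef h] at this
    norm_num at this
  have hSL2 : MemLp (fun ω => ∑ a ∈ σ, w a ω) 2 P := memLp_finsetSum _ fun a _ => hL2 a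
  have hint : ∀ a, Integrable (w a) P := fun a => (hL2 a).integrable (by norm_num)
  have hvar : ∫ ω, (∑ a ∈ σ, w a ω) ^ 2 ∂P = σ.card := by
    have e1 := IndepFun.variance_sum (μ := P) (X := w) (s := σ) (fun a _ => hL2 a)
      (fun a _ b _ hab => hind.indepFun hab)
    have e2 : ∀ a, variance (w a) P = 1 := fun a => by
      rw [variance_of_integral_eq_zero (hw a).aemeasurable (h0 a)]
      exact h1 a
    have e3 : (∑ a ∈ σ, w a) = fun ω => ∑ a ∈ σ, w a ω := by ext ω; simp
    rw [e3, variance_of_integral_eq_zero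
      (Finset.measurable_fun_sum _ fun a _ => hw a).aemeasurable] at e1
    · rw [e1]; simp [e2]
    · rw [integral_finsetSum _ fun a _ => hint a]; simp [h0]
  have hn0 : (0 : ℝ) < σ.card := by exact_mod_cast hσ
  have hsq : Integrable (fun ω => (∑ a ∈ σ, w a ω) ^ 2) P := hSL2.integrable_sq
  have hr2 : ((√(σ.card : ℝ))⁻¹) ^ 2 * σ.card = 1 := by
    rw [inv_pow, Real.sq_sqrt hn0.le, inv_mul_cancel₀ hn0.ne']
  set r := (√(σ.card : ℝ))⁻¹
  have hi : Integrable (fun ω => (1 + r ^ 2 * (∑ a ∈ σ, w a ω) ^ 2) / 2) P :=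
    ((integrable_const _).add (hsq.const_mul _)).div_const _
  calc ∫ ω, |r * ∑ a ∈ σ, w a ω| ∂P ≤ ∫ ω, (1 + r ^ 2 * (∑ a ∈ σ, w a ω) ^ 2) / 2 ∂P := by
        refine integral_mono ((integrable_finsetSum _ fun a _ => hint a).const_mul _).abs hi
          fun ω => ?_
        simp only
        rw [← mul_pow, ← sq_abs (r * _)]
        nlinarith [sq_nonneg (|r * ∑ a ∈ σ, w a ω| - 1)]
    _ = 1 := by
        rw [integral_div, integral_add (integrable_const _) (hsq.const_mul _), integral_const_mul,
          hvar, hr2]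
        simp

end

/-- Only countably many null sets can be discarded, so the almost sure statements are made at
rational frequencies and extended by equicontinuity. -/
theorem tendsto_of_tendsto_rat {A : ℕ → ℝ → ℝ} {φ : ℝ → ℝ} (hφ : Continuous φ)
    (hq : ∀ q : ℚ, Tendsto (fun N => A N q) atTop (𝓝 (φ q))) {C : ℝ} (hC : 0 < C)
    (hA : ∀ᶠ N in atTop, ∀ t u, |A N t - A N u| ≤ C * |t - u|) (t : ℝ) :
    Tendsto (fun N => A N t) atTop (𝓝 (φ t)) := by
  rw [Metric.tendsto_atTop']
  intro ε hε
  obtain ⟨η, hη, hφη⟩ := Metric.continuousAt_iff.1 hφ.continuousAt (ε / 3) (by positivity)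
  obtain ⟨q, hq1, hq2⟩ := exists_rat_btwn
    (show t < t + min η (ε / (3 * C)) by have : 0 < min η (ε / (3 * C)) := by positivity
                                         linarith)
  have hm1 := min_le_left η (ε / (3 * C))
  have hm2 := min_le_right η (ε / (3 * C))
  have habs : |t - q| = q - t := by rw [abs_sub_comm, abs_of_pos (by linarith)]
  have h1 : |φ q - φ t| < ε / 3 := by
    have := hφη (x := (q : ℝ)) (by rw [dist_comm, Real.dist_eq, habs]; linarith)
    rwa [Real.dist_eq] at this
  have h2 : C * |t - q| ≤ ε / 3 := by
    rw [habs]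
    calc C * (q - t) ≤ C * (ε / (3 * C)) := by gcongr; linarith
      _ = ε / 3 := by field_simp
  have h3 := Metric.tendsto_atTop.1 (hq q) (ε / 3) (by positivity)
  obtain ⟨N₁, hN₁⟩ := h3
  obtain ⟨N₂, hN₂⟩ := eventually_atTop.1 hA
  refine ⟨max N₁ N₂, fun N hN => ?_⟩
  have h4 := hN₁ N (le_trans (le_max_left _ _) hN.le)
  have h5 := (hN₂ N (le_trans (le_max_right _ _) hN.le) t q).trans h2
  rw [Real.dist_eq] at h4 ⊢
  calc |A N t - φ t| ≤ |A N t - A N q| + |A N q - φ q| + |φ q - φ t| := by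
        refine (abs_sub_le _ (φ q) _).trans ?_
        gcongr
        exact abs_sub_le _ _ _
    _ < ε := by linarith

/-- The summand 1 keeps the constant positive at `t = 0`, as `ae_tendsto_meanSum_sub` requires. -/
theorem lipschitzWith_cos_mul (t : ℝ) : LipschitzWith (‖t‖₊ + 1) fun x => Real.cos (t * x) := by
  refine LipschitzWith.of_dist_le_mul fun x y => ?_
  have := Real.lipschitzWith_cos.dist_le_mul (t * x) (t * y)
  rw [Real.dist_eq (t * x), ← mul_sub, abs_mul, ← Real.dist_eq x] at this
  refine this.trans ?_
  push_cast
  rw [one_mul, Real.norm_eq_abs]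
  have := dist_nonneg (x := x) (y := y)
  nlinarith

theorem lipschitzWith_sin_mul (t : ℝ) : LipschitzWith (‖t‖₊ + 1) fun x => Real.sin (t * x) := by
  refine LipschitzWith.of_dist_le_mul fun x y => ?_
  have := Real.lipschitzWith_sin.dist_le_mul (t * x) (t * y)
  rw [Real.dist_eq (t * x), ← mul_sub, abs_mul, ← Real.dist_eq x] at this
  refine this.trans ?_
  push_cast
  rw [one_mul, Real.norm_eq_abs]
  have := dist_nonneg (x := x) (y := y)
  nlinarith

theorem abs_avg_sub_le {κ : Type*} {S : Finset κ} {h : ℝ → ℝ} (hh : LipschitzWith 1 h)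
    (Y : κ → ℝ) (t u : ℝ) :
    |avg S (fun σ => h (t * Y σ)) - avg S fun σ => h (u * Y σ)|
      ≤ (avg S fun σ => |Y σ|) * |t - u| := by
  rw [avg_sub]
  refine abs_avg_le.trans ?_
  have : (avg S fun σ => |Y σ|) * |t - u| = avg S fun σ => |Y σ| * |t - u| := by
    unfold avg; rw [← Finset.sum_mul]; ring
  rw [this]
  refine avg_mono fun σ _ => ?_
  have := hh.dist_le_mul (t * Y σ) (u * Y σ)
  rw [Real.dist_eq, Real.dist_eq, ← sub_mul, abs_mul] at this
  push_cast at this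
  linarith

section

variable {ι : Type*} {Ω : Type*} [MeasurableSpace Ω] {P : Measure Ω} [IsProbabilityMeasure P]

/-- **Quenched central limit theorem** for the sum of independent weights over a uniform random
element of `S N`, provided that the overlaps are small: almost surely, the characteristic functions
converge. -/
theorem quenched_charFun_tendsto [Countable ι] [DecidableEq ι] {w : ι → Ω → ℝ}
    (hw : ∀ a, Measurable (w a)) (hind : iIndepFun w P)
    (h0 : ∀ a, ∫ ω, w a ω ∂P = 0) (h1 : ∀ a, ∫ ω, w a ω ^ 2 ∂P = 1)
    {M : ℝ} (h3 : ∀ a, Integrable (fun ω => |w a ω| ^ 3) P) (hM : ∀ a, ∫ ω, |w a ω| ^ 3 ∂P ≤ M)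
    (B : ι → ℝ≥0) {ρ : ι → ℝ} (hρ : Summable ρ)
    (hB : ∀ a, ∫ ω, |w a ω - clamp (B a) (w a ω)| ∂P ≤ ρ a) {S : ℕ → Finset (Finset ι)}
    {n : ℕ → ℕ} (hn : ∀ᶠ N in atTop, N ≤ n N) {C s : ℝ} (hC : 0 < C) (hs : 0 < s)
    (hS : ∀ᶠ N in atTop, ∑ a ∈ (S N).biUnion id,
      ((B a : ℝ) * ((S N).filter (a ∈ ·)).card / (S N).card) ^ 2 ≤ C * n N * (N : ℝ) ^ (-s))
    (hSne : ∀ᶠ N in atTop, (S N).Nonempty)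
    (hScard : ∀ᶠ N in atTop, ∀ σ ∈ S N, σ.card = n N) :
    ∀ᵐ ω ∂P, ∀ t : ℝ,
      Tendsto (fun N => avg (S N) fun σ => Real.cos (t * ((√(n N : ℝ))⁻¹ * ∑ a ∈ σ, w a ω)))
        atTop (𝓝 (Real.exp (-t ^ 2 / 2))) ∧
      Tendsto (fun N => avg (S N) fun σ => Real.sin (t * ((√(n N : ℝ))⁻¹ * ∑ a ∈ σ, w a ω)))
        atTop (𝓝 0) := by
  have hint : ∀ a, Integrable (w a) P := by
    intro a
    refine ((integrable_const 1).add (h3 a)).mono' (hw a).aestronglyMeasurable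
      (ae_of_all _ fun ω => ?_)
    rw [Real.norm_eq_abs, Pi.add_apply]
    rcases le_or_gt |w a ω| 1 with h | h
    · have : 0 ≤ |w a ω| ^ 3 := by positivity
      linarith
    · have := pow_le_pow_right₀ h.le (show 1 ≤ 3 by norm_num)
      rw [pow_one] at this
      linarith
  have hntop : Tendsto (fun N => (n N : ℝ)) atTop atTop :=
    tendsto_natCast_atTop_atTop.comp (tendsto_atTop_mono' _ hn tendsto_id)
  have hrtend : Tendsto (fun N => (√(n N : ℝ))⁻¹) atTop (𝓝 0) :=
    tendsto_inv_atTop_zero.comp (Real.tendsto_sqrt_atTop.comp hntop)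
  have hconc : ∀ {f : ℝ → ℝ} {L : ℝ≥0}, LipschitzWith L f → 0 < L → _ := fun {f L} hf hL =>
    ae_tendsto_meanSum_sub hw hind hint B hρ hB hn hC hs hS (f := f) (L := L) hf hL
  have hLpos : ∀ t : ℝ, 0 < ‖t‖₊ + 1 := fun t => by positivity
  have hcos := ae_all_iff.2 fun q : ℚ => hconc (lipschitzWith_cos_mul q) (hLpos q)
  have hsin := ae_all_iff.2 fun q : ℚ => hconc (lipschitzWith_sin_mul q) (hLpos q)
  -- Concentration for the absolute value: together with the bound 1 on the expectations, the
  -- average of the absolute normalised sums is eventually at most 2.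
  have habs := hconc (f := fun x => |x|) (L := 1)
    (LipschitzWith.of_dist_le_mul fun x y => by
      rw [NNReal.coe_one, one_mul]; exact abs_abs_sub_abs_le _ _) one_pos
  have hYm : ∀ (r : ℝ) (σ : Finset ι), Measurable fun ω => r * ∑ a ∈ σ, w a ω := fun r σ =>
    (Finset.measurable_fun_sum _ fun a _ => hw a).const_mul r
  have hclt : ∀ t : ℝ, ∀ᶠ N in atTop, ∀ σ ∈ S N,
      ‖charFun (P.map fun ω => (√(n N : ℝ))⁻¹ * ∑ a ∈ σ, w a ω) t
        - ((Real.exp (-t ^ 2 / 2) : ℝ) : ℂ)‖ ≤ (4 * |t| ^ 3 * M + t ^ 4) * (√(n N : ℝ))⁻¹ := by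
    intro t
    filter_upwards [hScard, hn, eventually_gt_atTop 0] with N hN hnN hN0 σ hσ
    have := norm_charFun_sum_sub_le hw hind h0 h1 h3 hM (σ := σ)
      (by rw [hN σ hσ]; omega) t
    rwa [hN σ hσ] at this
  have hlimr : ∀ t : ℝ, Tendsto (fun N => |(4 * |t| ^ 3 * M + t ^ 4)| * (√(n N : ℝ))⁻¹)
      atTop (𝓝 0) := fun t => by simpa using hrtend.const_mul |(4 * |t| ^ 3 * M + t ^ 4)|
  have hmcos : ∀ t : ℝ, Tendsto (fun N => avg (S N) fun σ =>
      ∫ ω, Real.cos (t * ((√(n N : ℝ))⁻¹ * ∑ a ∈ σ, w a ω)) ∂P) atTop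
      (𝓝 (Real.exp (-t ^ 2 / 2))) := by
    intro t
    rw [tendsto_iff_norm_sub_tendsto_zero]
    refine squeeze_zero' (Eventually.of_forall fun _ => norm_nonneg _) ?_ (hlimr t)
    filter_upwards [hclt t, hSne] with N hN hne
    rw [← avg_const hne (Real.exp (-t ^ 2 / 2)), avg_sub, Real.norm_eq_abs]
    refine abs_avg_le.trans (avg_le (by positivity) fun σ hσ => ?_)
    refine (abs_integral_cos_sub_le (hYm _ _) (hN σ hσ)).trans ?_
    gcongr
    exact le_abs_self _
  have hmsin : ∀ t : ℝ, Tendsto (fun N => avg (S N) fun σ =>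
      ∫ ω, Real.sin (t * ((√(n N : ℝ))⁻¹ * ∑ a ∈ σ, w a ω)) ∂P) atTop (𝓝 0) := by
    intro t
    refine squeeze_zero_norm' ?_ (hlimr t)
    filter_upwards [hclt t] with N hN
    refine abs_avg_le.trans (avg_le (by positivity) fun σ hσ => ?_)
    refine (abs_integral_sin_le (hYm _ _) (hN σ hσ)).trans ?_
    gcongr
    exact le_abs_self _
  have hmabs : ∀ᶠ N in atTop, (avg (S N) fun σ =>
      ∫ ω, |(√(n N : ℝ))⁻¹ * ∑ a ∈ σ, w a ω| ∂P) ≤ 1 := by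
    filter_upwards [hScard, hn, eventually_gt_atTop 0] with N hN hnN hN0
    refine avg_le zero_le_one fun σ hσ => ?_
    have := integral_abs_normalized_sum_le_one hw hind h0 h1 (σ := σ) (by rw [hN σ hσ]; omega)
    rwa [hN σ hσ] at this
  filter_upwards [hcos, hsin, habs] with ω hc hsn ha
  have hbound : ∀ᶠ N in atTop, (avg (S N) fun σ => |(√(n N : ℝ))⁻¹ * ∑ a ∈ σ, w a ω|) ≤ 2 := by
    filter_upwards [hmabs, ha.eventually_lt_const one_pos] with N hN1 hN2
    simp only [meanSum] at hN2
    linarith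
  have hequi : ∀ {h : ℝ → ℝ}, LipschitzWith 1 h → ∀ᶠ N in atTop, ∀ t u,
      |(avg (S N) fun σ => h (t * ((√(n N : ℝ))⁻¹ * ∑ a ∈ σ, w a ω)))
        - avg (S N) fun σ => h (u * ((√(n N : ℝ))⁻¹ * ∑ a ∈ σ, w a ω))| ≤ 2 * |t - u| := by
    intro h hh
    filter_upwards [hbound] with N hN t u
    refine (abs_avg_sub_le hh _ t u).trans ?_
    gcongr
  refine fun t => ⟨?_, ?_⟩
  · refine tendsto_of_tendsto_rat (A := fun N t => avg (S N) fun σ =>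
      Real.cos (t * ((√(n N : ℝ))⁻¹ * ∑ a ∈ σ, w a ω))) (φ := fun t => Real.exp (-t ^ 2 / 2))
      (by fun_prop) (fun q => ?_) two_pos (hequi Real.lipschitzWith_cos) t
    have := (hc q).add (hmcos q)
    simpa [meanSum] using this
  · refine tendsto_of_tendsto_rat (A := fun N t => avg (S N) fun σ =>
      Real.sin (t * ((√(n N : ℝ))⁻¹ * ∑ a ∈ σ, w a ω))) (φ := fun _ => 0)
      (by fun_prop) (fun q => ?_) two_pos (hequi Real.lipschitzWith_sin) t
    have := (hsn q).add (hmsin q)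
    simpa [meanSum] using this

end


/-! ### Discretising the macroscopic points. -/

theorem integral_uniformOn {α : Type*} [MeasurableSpace α] [MeasurableSingletonClass α]
    {s : Set α} (hs : s.Finite) (g : α → ℝ) : ∫ a, g a ∂(uniformOn s) = avg hs.toFinset g := by
  have h1 : (Measure.count s).toReal = hs.toFinset.card := by
    rw [Measure.count_apply_finite s hs]; simp
  rw [uniformOn, ProbabilityTheory.cond, integral_smul_measure, ENNReal.toReal_inv, h1, avg]
  have h2 := setIntegral_finset (μ := Measure.count) (f := g) hs.toFinset (by
    rw [← (hs.toFinset : Set α).biUnion_of_singleton]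
    exact integrableOn_finset_iUnion.2 fun a _ => integrableOn_singleton (hx := by simp))
  rw [hs.coe_toFinset] at h2
  rw [h2, smul_eq_mul, div_eq_inv_mul]
  simp [Measure.real]

/-- The sequence `0, x 0, …, x (l - 1), ξ, ξ, …`. -/
def knots {l : ℕ} (x : Fin l → ℝ) (ξ : ℝ) : ℕ → ℝ
  | 0 => 0
  | i + 1 => if h : i < l then x ⟨i, h⟩ else ξ

section Knots

variable {l : ℕ} {x : Fin l → ℝ} {ξ : ℝ}

theorem knots_zero : knots x ξ 0 = 0 := rfl

theorem knots_succ (i : ℕ) : knots x ξ (i + 1) = if h : i < l then x ⟨i, h⟩ else ξ := rfl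

theorem knots_lt_succ (hmono : StrictMono x) (hpos : ∀ i, 0 < x i) (hlt : ∀ i, x i < ξ)
    (hξ : 0 < ξ) {i : ℕ} (hi : i < l + 1) : knots x ξ i < knots x ξ (i + 1) := by
  rcases i with _ | i
  · rw [knots_zero, knots_succ]; split_ifs
    · exact hpos _
    · exact hξ
  · rw [knots_succ, knots_succ, dif_pos (by omega)]
    split_ifs
    · exact hmono (by simp)
    · exact hlt _

theorem knots_last : knots x ξ (l + 1) = ξ := by
  simp [knots]

theorem knots_monotone (hmono : StrictMono x) (hpos : ∀ i, 0 < x i) (hlt : ∀ i, x i < ξ)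
    (hξ : 0 < ξ) : Monotone (knots x ξ) := by
  refine monotone_nat_of_le_succ fun i => ?_
  rcases Nat.lt_or_ge i (l + 1) with hi | hi
  · exact (knots_lt_succ hmono hpos hlt hξ hi).le
  · obtain ⟨j, rfl⟩ : ∃ j, i = j + 1 := ⟨i - 1, by omega⟩
    rw [knots_succ, knots_succ, dif_neg (by omega), dif_neg (by omega)]

theorem exists_pos_le_of_pos (g : ℕ → ℝ) (m : ℕ) (hg : ∀ i < m, 0 < g i) :
    ∃ d > 0, ∀ i < m, d ≤ g i := by
  induction m with
  | zero => exact ⟨1, one_pos, fun i hi => absurd hi (by omega)⟩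
  | succ m ih =>
    obtain ⟨d, hd, h⟩ := ih fun i hi => hg i (by omega)
    refine ⟨min d (g m), lt_min hd (hg m (by omega)), fun i hi => ?_⟩
    rcases Nat.lt_or_ge i m with h' | h'
    · exact (min_le_left _ _).trans (h i h')
    · obtain rfl : i = m := by omega
      exact min_le_right _ _

end Knots

/-- The integer part of `y * N`, or `1` if it vanishes. -/
noncomputable def gridCoord (y : ℝ) (N : ℕ) : ℕ+ := ⟨max 1 ⌊y * N⌋₊, by omega⟩

theorem gridCoord_mono (N : ℕ) : Monotone fun y => gridCoord y N := by
  intro y y' h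
  rw [← PNat.coe_le_coe]
  exact max_le_max le_rfl (Nat.floor_mono (by gcongr))

/-- The default value 1 sends the macroscopic origin to the starting square `(1, 1)`. -/
theorem gridCoord_zero (N : ℕ) : gridCoord 0 N = 1 := by
  rw [← PNat.coe_inj]; simp [gridCoord]

theorem gridCoord_le {y : ℝ} (hy : 0 ≤ y) (N : ℕ) : (gridCoord y N : ℝ) ≤ y * N + 1 := by
  have : 0 ≤ y * N := by positivity
  have h1 := Nat.floor_le this
  simp only [gridCoord, PNat.mk_coe, Nat.cast_max, Nat.cast_one]
  exact max_le (by linarith) (by linarith)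

theorem le_gridCoord (y : ℝ) (N : ℕ) : y * N - 1 ≤ (gridCoord y N : ℝ) := by
  have h1 := Nat.lt_floor_add_one (y * N)
  simp only [gridCoord, PNat.mk_coe, Nat.cast_max, Nat.cast_one]
  exact le_max_of_le_right (by linarith)

theorem eventually_gridCoord_eq {y : ℝ} (hy : 0 < y) :
    ∀ᶠ N : ℕ in atTop, (gridCoord y N : ℕ) = ⌊y * N⌋₊ ∧ 0 < ⌊y * N⌋₊ := by
  filter_upwards [(tendsto_natCast_atTop_atTop (R := ℝ)).eventually_ge_atTop (1 / y)] with N hN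
  have : 0 < ⌊y * (N : ℝ)⌋₊ := by
    rw [Nat.floor_pos]
    rw [div_le_iff₀ hy] at hN
    linarith
  refine ⟨?_, this⟩
  simp only [gridCoord, PNat.mk_coe]
  omega

section Family

variable {ξ : ℝ} {l : ℕ} {x z : Fin l → ℝ}

/-- The microscopic chain of squares through which the paths are forced to go. -/
noncomputable def chainPts (ξ : ℝ) (x z : Fin l → ℝ) (N i : ℕ) : Square :=
  (gridCoord (knots x ξ i) N, gridCoord (knots z 1 i) N)

/-- The finset of paths of the corner growth model. -/
noncomputable def pathFinset (ξ : ℝ) (x z : Fin l → ℝ) (N : ℕ) : Finset (Finset Square) :=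
  (pathsThrough_finite ⌊ξ * N⌋₊ N (fun i => (⌊x i * N⌋₊, ⌊z i * N⌋₊))).toFinset

/-- The macroscopic gaps are at least some `d > 0`. Rounding costs at most 2 per increment, so the
microscopic gaps are at least `d * N / 2` once `N ≥ 4 / d`. The antidiagonal increments are at most
`(ξ + 3) * N`, and the quotient gives the slope constant. -/
theorem exists_eventually_isPathFamily (hξ : 0 < ξ)
    (hx_mono : StrictMono x) (hx_pos : ∀ i, 0 < x i) (hx_lt : ∀ i, x i < ξ)
    (hz_mono : StrictMono z) (hz_pos : ∀ i, 0 < z i) (hz_lt : ∀ i, z i < 1) :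
    ∃ δ, ∀ᶠ N : ℕ in atTop,
      IsPathFamily δ (l + 1) (chainPts ξ x z N) (pathFinset ξ x z N) ∧
      diag (chainPts ξ x z N (l + 1)) = ⌊ξ * N⌋₊ + N ∧ 0 < ⌊ξ * N⌋₊ ∧ 0 < N := by
  have hX := fun i hi => knots_lt_succ hx_mono hx_pos hx_lt hξ (i := i) hi
  have hZ := fun i hi => knots_lt_succ hz_mono hz_pos hz_lt one_pos (i := i) hi
  have hXm := knots_monotone hx_mono hx_pos hx_lt hξ
  have hZm := knots_monotone hz_mono hz_pos hz_lt one_pos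
  obtain ⟨d₁, hd₁, hd₁'⟩ := exists_pos_le_of_pos (fun i => knots x ξ (i + 1) - knots x ξ i) (l + 1)
    fun i hi => sub_pos.2 (hX i hi)
  obtain ⟨d₂, hd₂, hd₂'⟩ := exists_pos_le_of_pos (fun i => knots z 1 (i + 1) - knots z 1 i) (l + 1)
    fun i hi => sub_pos.2 (hZ i hi)
  have hd : 0 < min d₁ d₂ := lt_min hd₁ hd₂
  set d := min d₁ d₂ with hdd
  have hX0 : ∀ i, 0 ≤ knots x ξ i := fun i => hXm (Nat.zero_le i)
  have hZ0 : ∀ i, 0 ≤ knots z 1 i := fun i => hZm (Nat.zero_le i)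
  refine ⟨d / (2 * (ξ + 3)), ?_⟩
  have hxe : ∀ᶠ N : ℕ in atTop, ∀ i, (gridCoord (x i) N : ℕ) = ⌊x i * N⌋₊ ∧ 0 < ⌊x i * N⌋₊ :=
    eventually_all.2 fun i => eventually_gridCoord_eq (hx_pos i)
  have hze : ∀ᶠ N : ℕ in atTop, ∀ i, (gridCoord (z i) N : ℕ) = ⌊z i * N⌋₊ ∧ 0 < ⌊z i * N⌋₊ :=
    eventually_all.2 fun i => eventually_gridCoord_eq (hz_pos i)
  filter_upwards [hxe, hze, eventually_gridCoord_eq hξ, eventually_gridCoord_eq one_pos,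
    (tendsto_natCast_atTop_atTop (R := ℝ)).eventually_ge_atTop (4 / d), eventually_gt_atTop 0]
    with N hxN hzN hξN h1N hdN hN0
  rw [one_mul, Nat.floor_natCast] at h1N
  have hN1 : (1 : ℝ) ≤ N := by exact_mod_cast hN0
  rw [div_le_iff₀ hd] at hdN
  set f := chainPts ξ x z N with hf
  have hmono : Monotone f := fun i j hij => by
    rw [hf]
    exact Prod.mk_le_mk.2 ⟨gridCoord_mono N (hXm hij), gridCoord_mono N (hZm hij)⟩
  have hfirst : f 0 = (1, 1) := by
    simp only [hf, chainPts, knots, gridCoord_zero]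
  have hl1 : ((f (l + 1)).1 : ℕ) = ⌊ξ * N⌋₊ := by
    simp only [hf, chainPts, knots_last]; exact hξN.1
  have hl2 : ((f (l + 1)).2 : ℕ) = N := by
    simp only [hf, chainPts, knots_last]; exact h1N.1
  have hgap : ∀ i < l + 1, d / 2 * N ≤ ((f (i + 1)).1 : ℝ) - (f i).1 ∧
      d / 2 * N ≤ ((f (i + 1)).2 : ℝ) - (f i).2 := by
    intro i hi
    have e1 := le_gridCoord (knots x ξ (i + 1)) N
    have e2 := gridCoord_le (hX0 i) N
    have e3 := le_gridCoord (knots z 1 (i + 1)) N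
    have e4 := gridCoord_le (hZ0 i) N
    have g1 : d * N ≤ (knots x ξ (i + 1) - knots x ξ i) * N := by
      gcongr; exact (min_le_left _ _).trans (hd₁' i hi)
    have g2 : d * N ≤ (knots z 1 (i + 1) - knots z 1 i) * N := by
      gcongr; exact (min_le_right _ _).trans (hd₂' i hi)
    rw [sub_mul] at g1 g2
    simp only [hf, chainPts]
    constructor <;> nlinarith
  have hdiag : ∀ i < l + 1, (diag (f (i + 1)) : ℝ) - diag (f i) ≤ (ξ + 3) * N := by
    intro i hi
    have e1 := diag_mono (hmono (show i + 1 ≤ l + 1 by omega))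
    have e2 : (diag (f (i + 1)) : ℝ) ≤ diag (f (l + 1)) := by exact_mod_cast e1
    have e3 : (diag (f (l + 1)) : ℝ) = ⌊ξ * N⌋₊ + N := by
      unfold diag; rw [hl1, hl2]; push_cast; ring
    have e4 := Nat.floor_le (show 0 ≤ ξ * (N : ℝ) by positivity)
    have e5 : (0 : ℝ) ≤ diag (f i) := Nat.cast_nonneg _
    nlinarith
  have hslope : ∀ i < l + 1,
      d / (2 * (ξ + 3)) * ((diag (f (i + 1)) : ℝ) - diag (f i)) ≤ d / 2 * N := by
    intro i hi
    calc _ ≤ d / (2 * (ξ + 3)) * ((ξ + 3) * N) := by gcongr; exact hdiag i hi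
      _ = d / 2 * N := by field_simp
  refine ⟨⟨by positivity, hmono, fun σ => ?_, fun i hi => ?_,
    fun i hi => (hslope i hi).trans (hgap i hi).1, fun i hi => (hslope i hi).trans (hgap i hi).2⟩,
    by unfold diag; rw [hl1, hl2], hξN.2, hN0⟩
  · rw [pathFinset, Set.Finite.mem_toFinset]
    have hfk : ∀ k : Fin l, ∀ a : Square, ((a.1 : ℕ), (a.2 : ℕ)) = (⌊x k * N⌋₊, ⌊z k * N⌋₊) ↔
        a = f (k + 1) := by
      intro k a
      rw [Square.ext_iff, Prod.mk.injEq]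
      simp only [hf, chainPts, knots, k.2, dite_true, hxN, hzN]
    change IsUpRightPath _ _ σ ∧ (∀ k : Fin l, _) ↔ _
    rw [show ⌊ξ * (N : ℝ)⌋₊ = ((f (l + 1)).1 : ℕ) from hl1.symm]
    conv_lhs => lhs; rw [show N = ((f (l + 1)).2 : ℕ) from hl2.symm]
    rw [isUpRightPath_iff, ← hfirst]
    simp only [hfk]
    refine and_congr_right fun hp => ?_
    constructor
    · intro h i hi
      rcases i with _ | i
      · exact hp.left_mem (hmono (by omega))
      · rcases Nat.lt_or_ge i l with hil | hil
        · obtain ⟨a, ha, rfl⟩ := h ⟨i, hil⟩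
          exact ha
        · obtain rfl : i = l := by omega
          exact hp.right_mem (hmono (by omega))
    · exact fun h k => ⟨_, h (k + 1) (by omega), rfl⟩
  · have h1 := hgap i hi
    have h2 : 0 < d / 2 * (N : ℝ) := by positivity
    have h3 : ((f i).1 : ℝ) < (f (i + 1)).1 := by linarith
    have h4 : ((f i).2 : ℝ) < (f (i + 1)).2 := by linarith
    have h5 : ((f i).1 : ℕ) < (f (i + 1)).1 := by exact_mod_cast h3
    have h6 : ((f i).2 : ℕ) < (f (i + 1)).2 := by exact_mod_cast h4
    unfold diag
    omega

theorem IsPathFamily.nonempty {δ : ℝ} {n : ℕ} {f : ℕ → Square} {S : Finset (Finset Square)}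
    (h : IsPathFamily δ n f S) : S.Nonempty := by
  classical
  obtain ⟨σ, hσ⟩ := exists_isPath_through h.mono n
  exact ⟨σ, (h.mem_iff σ).2 hσ⟩

end Family

/-! ### The truncation heights: summable errors and small variance. -/

/-- The truncation height of the weight of a square. -/
noncomputable def cutoff (a : Square) : ℝ≥0 := (diag a : ℝ≥0) ^ (1 / 5 : ℝ)

theorem coe_cutoff (a : Square) : (cutoff a : ℝ) = (diag a : ℝ) ^ (1 / 5 : ℝ) := by
  simp [cutoff]

theorem one_le_diag (a : Square) : 1 ≤ diag a := by
  have := a.1.pos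
  unfold diag; omega

/-- Since `(i + j) ^ 2 ≥ i * j`, the double series is dominated by a product of two single series
with exponent `(p - 1) / 10 > 1`. -/
theorem summable_cutoff_rpow {p : ℝ} (hp : 12 < p) :
    Summable fun a : Square => (cutoff a : ℝ) ^ (1 - p) := by
  have hq : 1 < (p - 1) / 10 := by linarith
  have h1 : Summable fun i : ℕ+ => ((i : ℕ) : ℝ) ^ (-((p - 1) / 10)) :=
    (Real.summable_nat_rpow.2 (by linarith)).comp_injective PNat.coe_injective
  have h2 := h1.mul_of_nonneg h1 (fun i => by positivity) fun i => by positivity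
  refine Summable.of_nonneg_of_le (fun a => by positivity) (fun a => ?_) h2
  have ha1 : (0 : ℝ) < (a.1 : ℕ) := by exact_mod_cast a.1.pos
  have ha2 : (0 : ℝ) < (a.2 : ℕ) := by exact_mod_cast a.2.pos
  have hd : (diag a : ℝ) = (a.1 : ℕ) + (a.2 : ℕ) := by unfold diag; push_cast; ring
  rw [coe_cutoff, ← Real.rpow_mul (Nat.cast_nonneg _), ← Real.mul_rpow ha1.le ha2.le]
  have : (1 / 5 : ℝ) * (1 - p) = 2 * (-((p - 1) / 10)) := by ring
  rw [this, Real.rpow_mul (Nat.cast_nonneg _)]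
  refine Real.rpow_le_rpow_of_nonpos (by positivity) ?_ (by linarith)
  rw [hd, Real.rpow_two]
  nlinarith

/-- The squared cutoff contributes `m ^ (2/5)` and the overlap `m ^ (1/2)`, which together fall
short of `m` by the power `1/10`. Here `m` is the number of squares of a path. -/
theorem IsPathFamily.sum_sq_cutoff_le {δ : ℝ} {n : ℕ} {f : ℕ → Square}
    {S : Finset (Finset Square)} (h : IsPathFamily δ n f S) (hn : 0 < n) [DecidableEq Square]
    {m N : ℕ} (hm : diag (f n) = m + 1) (hN : 0 < N) (hNm : N ≤ m) :
    ∑ a ∈ S.biUnion id, ((cutoff a : ℝ) * (S.filter (a ∈ ·)).card / S.card) ^ 2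
      ≤ (96 / δ ^ 4 * (n + 1)) * m * (N : ℝ) ^ (-(1 / 10) : ℝ) := by
  have hδ := h.pos
  have hc0 : (0 : ℝ) < S.card := by exact_mod_cast h.nonempty.card_pos
  have hN0 : (0 : ℝ) < N := by exact_mod_cast hN
  have hm1 : (1 : ℝ) ≤ m := by exact_mod_cast hN.trans_le hNm
  have hm0 : (0 : ℝ) < m := by linarith
  -- As `m ≥ 1`, the quantity `3 * m` dominates both the largest antidiagonal index `m + 1` and the
  -- `m + 2` under the square root.
  have hcut : ∀ a ∈ S.biUnion id, (cutoff a : ℝ) ^ 2 ≤ (3 * m : ℝ) ^ (2 / 5 : ℝ) := by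
    intro a ha
    obtain ⟨σ, hσ, ha⟩ := Finset.mem_biUnion.1 ha
    have h1 := diag_mono ((((h.mem_iff σ).1 hσ).1).mem_Icc a ha).2
    rw [hm] at h1
    have h2 : (diag a : ℝ) ≤ m + 1 := by exact_mod_cast h1
    rw [coe_cutoff, ← Real.rpow_natCast, ← Real.rpow_mul (Nat.cast_nonneg _)]
    norm_num
    exact Real.rpow_le_rpow (Nat.cast_nonneg _) (by linarith) (by norm_num)
  calc ∑ a ∈ S.biUnion id, ((cutoff a : ℝ) * (S.filter (a ∈ ·)).card / S.card) ^ 2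
      = ∑ a ∈ S.biUnion id, (cutoff a : ℝ) ^ 2 * ((S.filter (a ∈ ·)).card : ℝ) ^ 2 / S.card ^ 2 :=
        Finset.sum_congr rfl fun a _ => by rw [div_pow, mul_pow]
    _ ≤ ∑ a ∈ S.biUnion id,
          (3 * m : ℝ) ^ (2 / 5 : ℝ) * ((S.filter (a ∈ ·)).card : ℝ) ^ 2 / S.card ^ 2 := by
        gcongr with a ha
        exact hcut a ha
    _ = (3 * m : ℝ) ^ (2 / 5 : ℝ) *
          (∑ a ∈ S.biUnion id, ((S.filter (a ∈ ·)).card : ℝ) ^ 2) / S.card ^ 2 := by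
        rw [← Finset.sum_div, ← Finset.mul_sum]
    _ ≤ (3 * m : ℝ) ^ (2 / 5 : ℝ) *
          (32 / δ ^ 4 * (n + 1) * √((diag (f n) + 1 : ℕ) : ℝ) * S.card ^ 2) / S.card ^ 2 := by
        gcongr
        exact h.sum_sq_card_le hn
    _ = 32 / δ ^ 4 * (n + 1) * ((3 * m : ℝ) ^ (2 / 5 : ℝ) * √((diag (f n) + 1 : ℕ) : ℝ)) := by
        field_simp
    _ ≤ 32 / δ ^ 4 * (n + 1) * ((3 * m : ℝ) ^ (2 / 5 : ℝ) * (3 * m : ℝ) ^ (1 / 2 : ℝ)) := by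
        rw [← Real.sqrt_eq_rpow]
        gcongr
        rw [hm]; push_cast; linarith
    _ = 32 / δ ^ 4 * (n + 1) * ((3 * m : ℝ) * (3 * m : ℝ) ^ (-(1 / 10) : ℝ)) := by
        rw [← Real.rpow_add (by positivity),
          ← Real.rpow_one_add' (x := 3 * (m : ℝ)) (y := -(1 / 10)) (by positivity) (by norm_num)]
        norm_num
    _ ≤ 32 / δ ^ 4 * (n + 1) * ((3 * m : ℝ) * (N : ℝ) ^ (-(1 / 10) : ℝ)) := by
        have hNm' : (N : ℝ) ≤ m := by exact_mod_cast hNm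
        have : (3 * m : ℝ) ^ (-(1 / 10) : ℝ) ≤ (N : ℝ) ^ (-(1 / 10) : ℝ) :=
          Real.rpow_le_rpow_of_nonpos hN0 (by linarith) (by norm_num)
        exact mul_le_mul_of_nonneg_left (mul_le_mul_of_nonneg_left this (by positivity))
          (by positivity)
    _ = _ := by ring

end CornerGrowth

/-! ### Assembling the corollary. -/

open CornerGrowth in
theorem corollary1p2
    {Ω : Type*} [MeasurableSpace Ω] (P : Measure Ω) [IsProbabilityMeasure P]
    (p K : ℝ) (hp : 12 < p) (hK : 0 < K)
    -- the random environment
    (w : CornerGrowth.Square → Ω → ℝ)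
    (hw_meas : ∀ a, Measurable (w a))
    (hw_indep : iIndepFun w P)
    (hw_mean : ∀ a, ∫ ω, w a ω ∂P = 0)
    (hw_var : ∀ a, ∫ ω, w a ω ^ 2 ∂P = 1)
    (hw_int : ∀ a, Integrable (fun ω => |w a ω| ^ p) P)
    (hw_moment : ∀ a, ∫ ω, |w a ω| ^ p ∂P ≤ K)
    -- the macroscopic points
    (ξ : ℝ) (hξ : 0 < ξ) (l : ℕ) (x z : Fin l → ℝ)
    (hx_mono : StrictMono x) (hx_pos : ∀ i, 0 < x i) (hx_lt : ∀ i, x i < ξ)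
    (hz_mono : StrictMono z) (hz_pos : ∀ i, 0 < z i) (hz_lt : ∀ i, z i < 1) :
    (∀ᶠ N : ℕ in atTop, (CornerGrowth.pathsThrough ⌊ξ * N⌋₊ N
        (fun i => (⌊x i * N⌋₊, ⌊z i * N⌋₊))).Nonempty) ∧
    ∀ᵐ ω ∂P, TendstoInDistribution
      (fun (N : ℕ) (σ : Finset CornerGrowth.Square) =>
        (√((⌊ξ * N⌋₊ : ℝ) + N - 1))⁻¹ * CornerGrowth.energy (fun a => w a ω) σ)
      atTop
      (id : ℝ → ℝ)
      (fun N : ℕ => CornerGrowth.uniformPath ⌊ξ * N⌋₊ N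
        (fun i => (⌊x i * N⌋₊, ⌊z i * N⌋₊)))
      (gaussianReal 0 1) := by
  classical
  obtain ⟨δ, hfam⟩ := exists_eventually_isPathFamily hξ hx_mono hx_pos hx_lt hz_mono hz_pos hz_lt
  have hne : ∀ᶠ N : ℕ in atTop, (pathsThrough ⌊ξ * N⌋₊ N
      (fun i => (⌊x i * N⌋₊, ⌊z i * N⌋₊))).Nonempty := by
    filter_upwards [hfam] with N hN
    obtain ⟨σ, hσ⟩ := hN.1.nonempty
    exact ⟨σ, (Set.Finite.mem_toFinset _).1 hσ⟩
  refine ⟨hne, ?_⟩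
  have hδ : 0 < δ := by
    obtain ⟨N, hN⟩ := hfam.exists
    exact hN.1.pos
  have hcube : ∀ a ω, |w a ω| ^ 3 ≤ 1 + |w a ω| ^ p := by
    intro a ω
    have h0 : 0 ≤ |w a ω| ^ p := by positivity
    rcases le_or_gt |w a ω| 1 with h | h
    · have := pow_le_one₀ (n := 3) (abs_nonneg (w a ω)) h
      linarith
    · have := Real.rpow_le_rpow_of_exponent_le h.le (show (3 : ℝ) ≤ p by linarith)
      rw [← Real.rpow_natCast]
      push_cast
      linarith
  have hcubeI : ∀ a, Integrable (fun ω => |w a ω| ^ 3) P := fun a =>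
    ((integrable_const 1).add (hw_int a)).mono' ((hw_meas a).abs.pow_const 3).aestronglyMeasurable
      (ae_of_all _ fun ω => by
        rw [Real.norm_eq_abs, abs_of_nonneg (by positivity)]; exact hcube a ω)
  have hcubeM : ∀ a, ∫ ω, |w a ω| ^ 3 ∂P ≤ 1 + K := by
    intro a
    calc _ ≤ ∫ ω, (1 + |w a ω| ^ p) ∂P :=
          integral_mono (hcubeI a) ((integrable_const 1).add (hw_int a)) (hcube a)
      _ = 1 + ∫ ω, |w a ω| ^ p ∂P := by rw [integral_add (integrable_const 1) (hw_int a)]; simp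
      _ ≤ 1 + K := by gcongr; exact hw_moment a
  have hcutpos : ∀ a, 0 < cutoff a := fun a => by
    have : 0 < diag a := one_le_diag a
    unfold cutoff; positivity
  have hB : ∀ a, ∫ ω, |w a ω - clamp (cutoff a) (w a ω)| ∂P ≤ K * (cutoff a : ℝ) ^ (1 - p) := by
    intro a
    calc _ ≤ ∫ ω, (cutoff a : ℝ) ^ (1 - p) * |w a ω| ^ p ∂P :=
          integral_mono_of_nonneg (ae_of_all _ fun _ => abs_nonneg _) ((hw_int a).const_mul _)
            (ae_of_all _ fun ω => abs_sub_clamp_le_rpow (hcutpos a) (by linarith) _)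
      _ = (cutoff a : ℝ) ^ (1 - p) * ∫ ω, |w a ω| ^ p ∂P := integral_const_mul _ _
      _ ≤ (cutoff a : ℝ) ^ (1 - p) * K := by gcongr; exact hw_moment a
      _ = _ := mul_comm _ _
  have key := quenched_charFun_tendsto hw_meas hw_indep hw_mean hw_var hcubeI hcubeM cutoff
    ((summable_cutoff_rpow hp).mul_left K) hB (S := pathFinset ξ x z)
    (n := fun N : ℕ => ⌊ξ * N⌋₊ + N - 1)
    (by filter_upwards [hfam] with N hN; omega)
    (C := 96 / δ ^ 4 * ((l + 1 : ℕ) + 1)) (s := 1 / 10) (by positivity) (by norm_num)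
    (by
      filter_upwards [hfam] with N hN
      exact hN.1.sum_sq_cutoff_le (by omega) (by omega) hN.2.2.2 (by omega))
    (by filter_upwards [hfam] with N hN using hN.1.nonempty)
    (by
      filter_upwards [hfam] with N hN σ hσ
      have h1 := ((hN.1.mem_iff σ).1 hσ).1.card
      -- Paths run from antidiagonal 2 to antidiagonal `⌊ξ * N⌋₊ + N`, hence have `⌊ξ * N⌋₊ + N - 1`
      -- squares.
      have h2 : diag (chainPts ξ x z N 0) = 2 := by
        simp only [chainPts, knots, gridCoord_zero]; rfl
      omega)
  filter_upwards [key] with ω hω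
  -- Lévy's continuity theorem reduces convergence in distribution to that of the characteristic
  -- functions.
  refine ⟨fun N => (Measurable.of_discrete).aemeasurable, aemeasurable_id,
    ProbabilityMeasure.tendsto_iff_tendsto_charFun.2 fun t => ?_⟩
  simp only [ProbabilityMeasure.coe_mk, Measure.map_id]
  have hlim : charFun (gaussianReal 0 1) t
      = ((Real.exp (-t ^ 2 / 2) : ℝ) : ℂ) + ((0 : ℝ) : ℂ) * Complex.I := by
    rw [charFun_gaussianReal]; push_cast; simp [neg_div]
  rw [hlim]
  have h1 := (Complex.continuous_ofReal.tendsto _).comp (hω t).1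
  have h2 := ((Complex.continuous_ofReal.tendsto _).comp (hω t).2).mul_const Complex.I
  refine (h1.add h2).congr' ?_
  -- For such `N` the law is the genuine uniform one; the Dirac default occurs only for finitely
  -- many `N`.
  filter_upwards [hfam, hne] with N hN hneN
  have hint : ∀ g : Finset Square → ℝ, ∫ σ, g σ ∂(uniformPath ⌊ξ * N⌋₊ N
      (fun i => (⌊x i * N⌋₊, ⌊z i * N⌋₊))) = avg (pathFinset ξ x z N) g := by
    intro g
    rw [uniformPath, if_pos hneN]
    exact integral_uniformOn _ g
  have hcast : ((⌊ξ * (N : ℝ)⌋₊ + N - 1 : ℕ) : ℝ) = (⌊ξ * (N : ℝ)⌋₊ : ℝ) + N - 1 := by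
    rw [Nat.cast_sub (by omega)]; push_cast; ring
  rw [charFun_map_eq_cos_add_sin (Measurable.of_discrete), hint, hint]
  simp only [Function.comp, hcast, energy]
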